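/- Let $n\ge 1$, let $Q$ be a real symmetric positive definite $n\times n$ matrix, and let $B$ be a real $n\times n$ matrix all of whose eigenvalues have negative real parts. For $0<t\le\infty$ put $$Q_t=\int_0^t e^{sB}Qe^{sB^*}\,ds ,$$ and let $\gamma_\infty$ be the Gaussian probability measure on $\mathbb R^n$ with Lebesgue density $(2\pi)^{-n/2}(\det Q_\infty)^{-1/2}\exp\left(-\tfrac12\langle Q_\infty^{-1}x,x\rangle\right)$. With $R(x)=\tfrac12\langle Q_\infty^{-1}x,x\rangle$ and $D_t=Q_\infty e^{-tB^*}Q_\infty^{-1}$, define for $t>0$ and $x,u\in\mathbb R^n$ the Mehler kernel $$K_t(x,u)=\Big(\frac{\det Q_\infty}{\det Q_t}\Big)^{1/2}e^{R(x)}\exp\Big[-\tfrac12\big\langle (Q_t^{-1}-Q_\infty^{-1})(u-D_tx),\,u-D_tx\big\rangle\Big],$$ and the Ornstein--Uhlenbeck semigroup $$\mathcal H_tf(x)=\int K_t(x,u)f(u)\,d\gamma_\infty(u),\qquad f\in L^1(\gamma_\infty)\ \text{real-valued}.$$ For $1\le\varrho<\infty$, an interval $I$ and $\phi:I\to\mathbb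 R$, let $$\|\phi\|_{v(\varrho),I}=\sup\Big(\sum_{i=1}^N|\phi(t_i)-\phi(t_{i-1})|^\varrho\Big)^{1/\varrho}\in[0,\infty],$$ the supremum being over all finite increasing sequences $t_0<\dots<t_N$ of points of $I$. **Theorem.** There is a constant $C>0$ depending only on $n$, $Q$ and $B$ such that the following holds for every $\varrho\in[1,\infty)$ and every $f\in L^1(\gamma_\infty)$. The integral defining $\mathcal H_tf(x)$ converges absolutely for all $t\ge1$ and $x\in\mathbb R^n$; the function $x\mapsto\|\mathcal H_tf(x)\|_{v(\varrho),[1,\infty)}$ (the seminorm being taken in the variable $t$) is measurable; and the operator mapping $f$ to this function is of weak type $(1,1)$ with respect to $\gamma_\infty$: $$\gamma_\infty\big\{x\in\mathbb R^n:\ \|\mathcal H_tf(x)\|_{v(\varrho),[1,\infty)}>\alpha\big\}\le\frac C\alpha\,\|f\|_{L^1(\gamma_\infty)},\qquad \alpha>0.$$ Moreover, if $\|f\|_{L^1(\gamma_\infty)}=1$, then $$\gamma_\infty\big\{x\in\mathbb R^n:\ \|\mathcal H_tf(x)\|_{v(\varrho),[1,\infty)}>\alpha\big\}\le\frac{C}{\alpha\sqrt{\log\alpha}},\qquad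 \alpha>2.$$ -/

import Mathlib

open MeasureTheory
open scoped ENNReal Matrix

noncomputable section

namespace OrnsteinUhlenbeck

/-- All complex eigenvalues of the real matrix `B` have negative real part. -/
def IsStable {n : ℕ} (B : Matrix (Fin n) (Fin n) ℝ) : Prop :=
  ∀ z ∈ spectrum ℂ (B.map (algebraMap ℝ ℂ)), z.re < 0

/-- The integrand `e^{sB} Q e^{sB*}`; `B* = Bᵀ` since `B` is real. -/
def covIntegrand {n : ℕ} (Q B : Matrix (Fin n) (Fin n) ℝ) (s : ℝ) : Matrix (Fin n) (Fin n) ℝ :=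
  NormedSpace.exp (s • B) * Q * NormedSpace.exp (s • Bᵀ)

/-- `Q_t = ∫_0^t e^{sB} Q e^{sB*} ds` for finite `t`, integrated entry by entry. -/
def Qt {n : ℕ} (Q B : Matrix (Fin n) (Fin n) ℝ) (t : ℝ) : Matrix (Fin n) (Fin n) ℝ :=
  Matrix.of fun i j => ∫ s in Set.Ioc 0 t, covIntegrand Q B s i j

/-- `Q_∞ = ∫_0^∞ e^{sB} Q e^{sB*} ds`, integrated entry by entry. -/
def Qinf {n : ℕ} (Q B : Matrix (Fin n) (Fin n) ℝ) : Matrix (Fin n) (Fin n) ℝ :=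
  Matrix.of fun i j => ∫ s in Set.Ioi 0, covIntegrand Q B s i j

/-- The invariant Gaussian measure `γ_∞` on `ℝⁿ`, by its density
`(2π)^{-n/2} (det Q_∞)^{-1/2} exp (-⟨Q_∞⁻¹ x, x⟩ / 2)` with respect to Lebesgue measure.
(Points of `ℝⁿ` are functions `Fin n → ℝ`, and `⬝ᵥ` is the Euclidean inner product;
no norm of `ℝⁿ` occurs.) -/
def gammaInf {n : ℕ} (Q B : Matrix (Fin n) (Fin n) ℝ) : Measure (Fin n → ℝ) :=
  (volume : Measure (Fin n → ℝ)).withDensity fun x =>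
    ENNReal.ofReal ((2 * Real.pi) ^ (-(n : ℝ) / 2) * (Qinf Q B).det ^ (-(1 : ℝ) / 2) *
      Real.exp (-(1 / 2) * (((Qinf Q B)⁻¹ *ᵥ x) ⬝ᵥ x)))

/-- The quadratic form `R(x) = ⟨Q_∞⁻¹ x, x⟩ / 2`. -/
def R {n : ℕ} (Q B : Matrix (Fin n) (Fin n) ℝ) (x : Fin n → ℝ) : ℝ :=
  (1 / 2) * (((Qinf Q B)⁻¹ *ᵥ x) ⬝ᵥ x)

/-- `D_t = Q_∞ e^{-tB*} Q_∞⁻¹`. -/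
def D {n : ℕ} (Q B : Matrix (Fin n) (Fin n) ℝ) (t : ℝ) : Matrix (Fin n) (Fin n) ℝ :=
  Qinf Q B * NormedSpace.exp ((-t) • Bᵀ) * (Qinf Q B)⁻¹

/-- The Mehler kernel `K_t(x,u)` (with respect to `γ_∞`). -/
def mehlerKernel {n : ℕ} (Q B : Matrix (Fin n) (Fin n) ℝ) (t : ℝ) (x u : Fin n → ℝ) : ℝ :=
  Real.sqrt ((Qinf Q B).det / (Qt Q B t).det) * Real.exp (R Q B x) *
    Real.exp (-(1 / 2) *
      ((((Qt Q B t)⁻¹ - (Qinf Q B)⁻¹) *ᵥ (u - D Q B t *ᵥ x)) ⬝ᵥ (u - D Q B t *ᵥ x)))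

/-- The Ornstein–Uhlenbeck semigroup on `L¹(γ_∞)`:
`𝓗_t f(x) = ∫ K_t(x,u) f(u) dγ_∞(u)`, for `t > 0`. -/
def semigroup {n : ℕ} (Q B : Matrix (Fin n) (Fin n) ℝ) (t : ℝ) (f : (Fin n → ℝ) → ℝ)
    (x : Fin n → ℝ) : ℝ :=
  ∫ u, mehlerKernel Q B t x u * f u ∂(gammaInf Q B)

/-- The `ϱ`-th order variation seminorm of `φ` on `I`, with values in `[0,∞]`: the supremum of
`(∑_{i=1}^N |φ(t_i) - φ(t_{i-1})|^ϱ)^{1/ϱ}` over all finite increasing sequences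
`t_0 < ⋯ < t_N` of points of `I`. -/
def variation (ϱ : ℝ) (I : Set ℝ) (φ : ℝ → ℝ) : ℝ≥0∞ :=
  ⨆ (N : ℕ) (t : Fin (N + 1) → ℝ) (_ : StrictMono t) (_ : ∀ i, t i ∈ I),
    (∑ i : Fin N, ENNReal.ofReal |φ (t i.succ) - φ (t i.castSucc)| ^ ϱ) ^ (1 / ϱ)

/-- The variation operator `f ↦ ‖𝓗_t f(x)‖_{v(ϱ), I}`, the seminorm being taken in `t`. -/
def variationOp {n : ℕ} (Q B : Matrix (Fin n) (Fin n) ℝ) (ϱ : ℝ) (I : Set ℝ)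
    (f : (Fin n → ℝ) → ℝ) (x : Fin n → ℝ) : ℝ≥0∞ :=
  variation ϱ I fun t => semigroup Q B t f x

end OrnsteinUhlenbeck

end

/-!
The variation operator is dominated by a positive integral operator: the `ϱ`-variation is at most
the `1`-variation, which is at most `∫_1^∞ |∂_t 𝓗_t f(x)| dt`, so the kernel
`V(x, u) = ∫_1^∞ |∂_t K_t(x, u)| dt` is what has to be understood.

**The kernel.** Let `N(x) = R(x)^{1/2}` and `v_t = D_{-t} u`. Since
`Q_t = Q_∞ - e^{tB} Q_∞ e^{tB*}`, the exponent of the Mehler kernel is a quadratic form in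
`x - v_t`, with matrix `Q_∞⁻¹ + e^{tB*} Q_t⁻¹ e^{tB}` (`mehlerKernel_eq`). It is at least
`R(x - v_t)`, and all coefficients converge exponentially as `t → ∞`. Hence, for `t ≥ 1`
(`exists_bound_deriv_mehlerKernel`),
`|∂_t K_t(x, u)| ≤ C e^{R(x)} e^{-N(x - v_t)² / 2} (e^{-ct} + N(v_t))`.
By the Lyapunov equation `B Q_∞ + Q_∞ B* = -Q`, the derivative of `N(D_s x)²` in `s` is comparable
with `N(D_s x)²`; so `N(v_t)` is comparable with the speed of `t ↦ v_t`, and `V(x, u)` is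
`e^{R(x)}` times a Gaussian integral along the backward orbit of `u`, up to a small error. From
here on only the notion of an expanding flow (`IsExpandingFlow`) is used.

**The enhanced estimate.** Let `‖f‖₁ = 1` and `β = log α`. The orbit integral is bounded
(`exists_variationMajorant_le`), so the region `R(x) < β / 2` does not matter for large `α`; the
region `R(x) > 2β` has measure `O(α^{-3/2})`. In the annulus between them let `F(x)` be the average
of the orbit integral against `|f| dγ_∞`. The function `F` is almost constant along the flow for
times in `[0, 1]` (`orbitKernel_mulVec_le`). Averaging over these times turns the Gaussian measure
of `{e^R F > α}` into integrals of `e^{-R}` along orbits; on each orbit `e^{-R}` is at most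
`F / α` and decays at rate `β`, which leaves `(αβ)⁻¹ ∫ F(y) dy` over the ellipsoid `R ≤ 2β`
(`exists_setLIntegral_superlevel_le`). For each `u` the orbit integral is concentrated in a tube of
bounded width around a curve of length `O(√β)` (`exists_lintegral_orbitKernel_le`), so the last
integral is `O(√β)`, and the bound `O((α √β)⁻¹)` follows.

The weak type `(1,1)` estimate follows from the enhanced one when `α > 2 ‖f‖₁`, and from the
finiteness of `γ_∞` otherwise.
-/

namespace OrnsteinUhlenbeck

open Filter Topology Set

variable {n : ℕ}

/-! ### Exponential decay of the matrix semigroup -/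

section Decay

attribute [local instance] Matrix.linftyOpNormedRing Matrix.linftyOpNormedAlgebra

lemma exp_mulVec_of_mulVec_eq_smul {A : Matrix (Fin n) (Fin n) ℂ} {l : ℂ} {v : Fin n → ℂ}
    (h : A *ᵥ v = l • v) : NormedSpace.exp A *ᵥ v = Complex.exp l • v := by
  have hpow : ∀ k : ℕ, (A ^ k) *ᵥ v = l ^ k • v := by
    intro k
    induction k with
    | zero => simp
    | succ k ih =>
      rw [pow_succ, ← Matrix.mulVec_mulVec, h, Matrix.mulVec_smul, ih, smul_smul, pow_succ,
        mul_comm]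
  have h1 := NormedSpace.exp_series_hasSum_exp' (𝕂 := ℂ) A
  have h2 := NormedSpace.exp_series_hasSum_exp' (𝕂 := ℂ) l
  let T : Matrix (Fin n) (Fin n) ℂ →ₗ[ℂ] (Fin n → ℂ) := (Matrix.mulVecBilin ℂ ℂ).flip v
  have hT : ∀ M, T M = M *ᵥ v := fun M => rfl
  have h3 := h1.mapL T.toContinuousLinearMap
  have h4 := h2.smul_const v
  simp only [LinearMap.coe_toContinuousLinearMap', map_smul, hT, hpow] at h3
  rw [Complex.exp_eq_exp_ℂ]
  refine h3.unique ?_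
  simpa [smul_smul] using h4

/-- Every eigenvalue of `exp A` is the exponential of an eigenvalue of `A`, because `A` has an
eigenvector in each eigenspace of `exp A`. -/
lemma exists_exp_eq_of_mem_spectrum_exp {A : Matrix (Fin n) (Fin n) ℂ} {z : ℂ}
    (hz : z ∈ spectrum ℂ (NormedSpace.exp A)) : ∃ l ∈ spectrum ℂ A, Complex.exp l = z := by
  have hz' : z ∈ spectrum ℂ (Matrix.toLin' (NormedSpace.exp A)) := by
    rwa [Matrix.spectrum_toLin']
  rw [← Module.End.hasEigenvalue_iff_mem_spectrum] at hz'
  set g : Module.End ℂ (Fin n → ℂ) := Matrix.toLin' (NormedSpace.exp A) with hg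
  set f : Module.End ℂ (Fin n → ℂ) := Matrix.toLin' A with hf
  have hcomm : Commute g f := by
    have : Commute (NormedSpace.exp A) A := (Commute.refl A).exp_left
    change g * f = f * g
    rw [hg, hf, Module.End.mul_eq_comp, Module.End.mul_eq_comp, ← Matrix.toLin'_mul,
      ← Matrix.toLin'_mul, this.eq]
  have hmaps : MapsTo f (g.eigenspace z) (g.eigenspace z) :=
    Module.End.mapsTo_genEigenspace_of_comm hcomm z 1
  have : Nontrivial (g.eigenspace z) := Submodule.nontrivial_iff_ne_bot.2 hz'
  obtain ⟨l, hl⟩ := Module.End.exists_eigenvalue (f.restrict hmaps)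
  obtain ⟨v, hv⟩ := hl.exists_hasEigenvector
  have hv1 : A *ᵥ (v : Fin n → ℂ) = l • (v : Fin n → ℂ) := by
    have := congrArg Subtype.val hv.apply_eq_smul
    simpa [hf] using this
  have hv0 : (v : Fin n → ℂ) ≠ 0 := fun h => hv.2 (Subtype.ext h)
  refine ⟨l, ?_, ?_⟩
  · rw [← Matrix.spectrum_toLin', ← Module.End.hasEigenvalue_iff_mem_spectrum]
    exact Module.End.hasEigenvalue_of_hasEigenvector
      (x := (v : Fin n → ℂ)) ⟨Module.End.mem_eigenspace_iff.2 (by simpa using hv1), hv0⟩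
  · have h1 := exp_mulVec_of_mulVec_eq_smul hv1
    have h2 : NormedSpace.exp A *ᵥ (v : Fin n → ℂ) = z • (v : Fin n → ℂ) := by
      have := Module.End.mem_eigenspace_iff.1 v.2
      simpa [hg] using this
    have h3 : (Complex.exp l - z) • (v : Fin n → ℂ) = 0 := by
      rw [sub_smul, ← h1, ← h2, sub_self]
    exact sub_eq_zero.1 ((smul_eq_zero.1 h3).resolve_right hv0)

lemma linfty_norm_map_complex (M : Matrix (Fin n) (Fin n) ℝ) :
    ‖M.map (algebraMap ℝ ℂ)‖ = ‖M‖ := by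
  simp [Matrix.linfty_opNorm_def]

lemma exp_map_complex (M : Matrix (Fin n) (Fin n) ℝ) :
    (NormedSpace.exp M).map (algebraMap ℝ ℂ) = NormedSpace.exp (M.map (algebraMap ℝ ℂ)) := by
  have hc : Continuous ((algebraMap ℝ ℂ).mapMatrix (m := Fin n)) := by
    change Continuous fun M : Matrix (Fin n) (Fin n) ℝ => M.map (algebraMap ℝ ℂ)
    exact Continuous.matrix_map continuous_id (by fun_prop)
  exact NormedSpace.map_exp ((algebraMap ℝ ℂ).mapMatrix (m := Fin n)) hc M

lemma exists_norm_exp_pow_lt_one (hn : 1 ≤ n) {B : Matrix (Fin n) (Fin n) ℝ} (hB : IsStable B) :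
    ∃ k : ℕ, 1 ≤ k ∧ ‖NormedSpace.exp B ^ k‖ < 1 := by
  have : Nonempty (Fin n) := ⟨⟨0, hn⟩⟩
  set A := NormedSpace.exp (B.map (algebraMap ℝ ℂ)) with hA
  have h1 : spectralRadius ℂ A < 1 := by
    refine spectrum.spectralRadius_lt_of_forall_lt A (r := 1) fun z hz => ?_
    obtain ⟨l, hl, rfl⟩ := exists_exp_eq_of_mem_spectrum_exp hz
    rw [← NNReal.coe_lt_coe, coe_nnnorm, Complex.norm_exp, NNReal.coe_one]
    exact Real.exp_zero ▸ Real.exp_lt_exp.2 (hB l hl)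
  have h2 := spectrum.pow_nnnorm_pow_one_div_tendsto_nhds_spectralRadius A
  obtain ⟨k, hk, hk1⟩ := ((h2.eventually_lt_const h1).and (eventually_ge_atTop 1)).exists
  refine ⟨k, hk1, ?_⟩
  have hk0 : (0 : ℝ) < k := by exact_mod_cast hk1
  have h3 : (‖A ^ k‖₊ : ℝ≥0∞) < 1 := by
    by_contra h
    exact absurd hk (not_lt.2 (ENNReal.one_le_rpow (not_lt.1 h) (by positivity)))
  have h4 : ‖A ^ k‖ < 1 := by exact_mod_cast h3
  rw [← linfty_norm_map_complex]
  have h5 : (NormedSpace.exp B ^ k).map (algebraMap ℝ ℂ) = A ^ k := by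
    rw [hA, ← exp_map_complex, Matrix.map_pow]
  rwa [h5]

/-- The semigroup generated by a stable matrix decays exponentially. -/
lemma exists_norm_exp_le (hn : 1 ≤ n) {B : Matrix (Fin n) (Fin n) ℝ} (hB : IsStable B) :
    ∃ C c : ℝ, 0 < C ∧ 0 < c ∧
      ∀ t : ℝ, 0 ≤ t → ‖NormedSpace.exp (t • B)‖ ≤ C * Real.exp (-c * t) := by
  obtain ⟨k, hk1, hk⟩ := exists_norm_exp_pow_lt_one hn hB
  have hk0 : (0 : ℝ) < k := by exact_mod_cast hk1
  set q := max ‖NormedSpace.exp B ^ k‖ (1 / 2) with hq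
  have hq0 : 0 < q := lt_of_lt_of_le (by norm_num) (le_max_right _ _)
  have hq1 : q < 1 := max_lt hk (by norm_num)
  have hlog : Real.log q < 0 := Real.log_neg hq0 hq1
  have hcont : Continuous fun t : ℝ => ‖NormedSpace.exp (t • B)‖ := by
    refine Continuous.norm ?_
    exact continuous_iff_continuousAt.2 fun t => (hasDerivAt_exp_smul_const B t).continuousAt
  obtain ⟨K, hK⟩ := (isCompact_Icc (a := (0 : ℝ)) (b := k)).bddAbove_image hcont.continuousOn
  have hK' : ∀ t ∈ Icc (0 : ℝ) k, ‖NormedSpace.exp (t • B)‖ ≤ K := fun t ht =>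
    hK (mem_image_of_mem _ ht)
  refine ⟨(|K| + 1) / q, -Real.log q / k, by positivity, div_pos (by linarith) hk0, fun t ht => ?_⟩
  set m := ⌊t / k⌋₊ with hm
  have hm1 : (m : ℝ) * k ≤ t := by
    have := Nat.floor_le (div_nonneg ht hk0.le)
    rwa [le_div_iff₀ hk0] at this
  have hm2 : t < (m + 1) * k := by
    have := Nat.lt_floor_add_one (t / k)
    rwa [div_lt_iff₀ hk0] at this
  have hdec : NormedSpace.exp (t • B) =
      (NormedSpace.exp B ^ k) ^ m * NormedSpace.exp ((t - m * k) • B) := by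
    rw [← Matrix.exp_nsmul, ← Matrix.exp_nsmul, ← Matrix.exp_add_of_commute]
    · congr 1
      rw [← Nat.cast_smul_eq_nsmul ℝ, ← Nat.cast_smul_eq_nsmul ℝ, smul_smul, ← add_smul]
      congr 1; ring
    · exact ((((Commute.refl B).smul_right _).smul_left _).smul_left _)
  have hone : ‖(NormedSpace.exp B ^ k) ^ m‖ ≤ q ^ m := by
    rcases Nat.eq_zero_or_pos m with h0 | h0
    · have : Nonempty (Fin n) := ⟨⟨0, hn⟩⟩
      rw [h0]; simp
    · exact (norm_pow_le' _ h0).trans (by gcongr; exact le_max_left _ _)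
  rw [hdec]
  refine (norm_mul_le _ _).trans ?_
  have h1 : ‖NormedSpace.exp ((t - m * k) • B)‖ ≤ |K| + 1 :=
    (hK' _ ⟨by linarith, by linarith⟩).trans (by linarith [le_abs_self K])
  have h2 : q ^ m ≤ q⁻¹ * Real.exp (-(-Real.log q / k) * t) := by
    have : q ^ m = Real.exp (m * Real.log q) := by
      rw [mul_comm, Real.exp_mul, Real.exp_log hq0, Real.rpow_natCast]
    have h' : q⁻¹ = Real.exp (-Real.log q) := by rw [Real.exp_neg, Real.exp_log hq0]
    rw [this, h', ← Real.exp_add]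
    apply Real.exp_le_exp.2
    have h3 : t / k ≤ m + 1 := by rw [div_le_iff₀ hk0]; exact hm2.le
    have h4 : -(-Real.log q / k) * t = Real.log q * (t / k) := by ring
    rw [h4]
    nlinarith
  calc _ ≤ q ^ m * (|K| + 1) := by gcongr
    _ ≤ (q⁻¹ * Real.exp (-(-Real.log q / k) * t)) * (|K| + 1) := by gcongr
    _ = _ := by field_simp

end Decay

/-! ### The covariance matrices and the Lyapunov equation -/

section Covariance

attribute [local instance] Matrix.linftyOpNormedRing Matrix.linftyOpNormedAlgebra

lemma isStable_transpose {B : Matrix (Fin n) (Fin n) ℝ} (hB : IsStable B) : IsStable Bᵀ := by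
  intro z hz
  refine hB z ?_
  rw [spectrum.mem_iff] at hz ⊢
  rwa [Matrix.transpose_map, ← Matrix.isUnit_transpose, Matrix.transpose_sub,
    Matrix.transpose_transpose, Algebra.algebraMap_eq_smul_one, Matrix.transpose_smul,
    Matrix.transpose_one, ← Algebra.algebraMap_eq_smul_one] at hz

lemma exp_smul_transpose (B : Matrix (Fin n) (Fin n) ℝ) (t : ℝ) :
    NormedSpace.exp (t • Bᵀ) = (NormedSpace.exp (t • B))ᵀ := by
  rw [← Matrix.exp_transpose, Matrix.transpose_smul]

lemma exp_smul_add (B : Matrix (Fin n) (Fin n) ℝ) (s t : ℝ) :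
    NormedSpace.exp ((s + t) • B) = NormedSpace.exp (s • B) * NormedSpace.exp (t • B) := by
  rw [add_smul]
  exact Matrix.exp_add_of_commute _ _ (((Commute.refl B).smul_right _).smul_left _)

lemma exp_smul_mul_exp_neg_smul (B : Matrix (Fin n) (Fin n) ℝ) (t : ℝ) :
    NormedSpace.exp (t • B) * NormedSpace.exp ((-t) • B) = 1 := by
  rw [← exp_smul_add]; simp

lemma abs_entry_le_norm (M : Matrix (Fin n) (Fin n) ℝ) (i j : Fin n) : |M i j| ≤ ‖M‖ := by
  rw [Matrix.linfty_opNorm_def]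
  have h1 : ‖M i j‖₊ ≤ ∑ k, ‖M i k‖₊ :=
    Finset.single_le_sum (f := fun k => ‖M i k‖₊) (fun _ _ => zero_le) (Finset.mem_univ j)
  have h2 := Finset.le_sup (f := fun i => ∑ k, ‖M i k‖₊) (Finset.mem_univ i)
  exact_mod_cast h1.trans h2

lemma hasDerivAt_linearMap_comp {F : Type*} [NormedAddCommGroup F] [NormedSpace ℝ F]
    {M : ℝ → Matrix (Fin n) (Fin n) ℝ} {M' : Matrix (Fin n) (Fin n) ℝ} {t : ℝ}
    (h : HasDerivAt M M' t) (l : Matrix (Fin n) (Fin n) ℝ →ₗ[ℝ] F) :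
    HasDerivAt (fun s => l (M s)) (l M') t :=
  (l.toContinuousLinearMap).hasFDerivAt.comp_hasDerivAt t h

lemma hasDerivAt_entry
    {M : ℝ → Matrix (Fin n) (Fin n) ℝ} {M' : Matrix (Fin n) (Fin n) ℝ} {t : ℝ}
    (h : HasDerivAt M M' t) (i j : Fin n) :
    HasDerivAt (fun s => M s i j) (M' i j) t :=
  hasDerivAt_linearMap_comp h (Matrix.entryLinearMap ℝ ℝ i j)

lemma hasDerivAt_matrix_form
    {M : ℝ → Matrix (Fin n) (Fin n) ℝ} {M' : Matrix (Fin n) (Fin n) ℝ} {t : ℝ}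
    (h : HasDerivAt M M' t) (x y : Fin n → ℝ) :
    HasDerivAt (fun s => x ⬝ᵥ (M s *ᵥ y)) (x ⬝ᵥ (M' *ᵥ y)) t := by
  let l : Matrix (Fin n) (Fin n) ℝ →ₗ[ℝ] ℝ :=
    (dotProductBilin ℝ ℝ x).comp ((Matrix.mulVecBilin ℝ ℝ).flip y)
  exact hasDerivAt_linearMap_comp h l

lemma hasDerivAt_covIntegrand (X B : Matrix (Fin n) (Fin n) ℝ) (s : ℝ) :
    HasDerivAt (covIntegrand X B) (covIntegrand (B * X + X * Bᵀ) B s) s := by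
  have h1 := hasDerivAt_exp_smul_const B s
  have h2 := hasDerivAt_exp_smul_const' Bᵀ s
  have h := (h1.mul_const X).mul h2
  refine h.congr_deriv ?_
  simp only [covIntegrand]
  noncomm_ring

lemma continuous_covIntegrand (X B : Matrix (Fin n) (Fin n) ℝ) : Continuous (covIntegrand X B) :=
  continuous_iff_continuousAt.2 fun s => (hasDerivAt_covIntegrand X B s).continuousAt

lemma covIntegrand_zero (X B : Matrix (Fin n) (Fin n) ℝ) : covIntegrand X B 0 = X := by
  simp [covIntegrand]

lemma covIntegrand_neg (X B : Matrix (Fin n) (Fin n) ℝ) (s : ℝ) :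
    covIntegrand (-X) B s = - covIntegrand X B s := by
  simp [covIntegrand]

lemma covIntegrand_transpose {X B : Matrix (Fin n) (Fin n) ℝ} (hX : Xᵀ = X) (s : ℝ) :
    (covIntegrand X B s)ᵀ = covIntegrand X B s := by
  simp [covIntegrand, exp_smul_transpose, hX, Matrix.mul_assoc]

lemma covIntegrand_lyapunov (X B : Matrix (Fin n) (Fin n) ℝ) (s : ℝ) :
    covIntegrand (B * X + X * Bᵀ) B s = B * covIntegrand X B s + covIntegrand X B s * Bᵀ := by
  have h1 : Commute (NormedSpace.exp (s • B)) B := ((Commute.refl B).smul_left s).exp_left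
  have h2 : Commute (NormedSpace.exp (s • Bᵀ)) Bᵀ := ((Commute.refl Bᵀ).smul_left s).exp_left
  simp only [covIntegrand, mul_add, add_mul]
  rw [← mul_assoc, h1.eq]
  simp only [mul_assoc]
  rw [h2.eq]

lemma exists_norm_covIntegrand_le (hn : 1 ≤ n) {B : Matrix (Fin n) (Fin n) ℝ} (hB : IsStable B)
    (X : Matrix (Fin n) (Fin n) ℝ) :
    ∃ C c : ℝ, 0 < C ∧ 0 < c ∧
      ∀ t : ℝ, 0 ≤ t → ‖covIntegrand X B t‖ ≤ C * Real.exp (-c * t) := by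
  obtain ⟨C₁, c₁, hC₁, hc₁, h₁⟩ := exists_norm_exp_le hn hB
  obtain ⟨C₂, c₂, hC₂, hc₂, h₂⟩ := exists_norm_exp_le hn (isStable_transpose hB)
  refine ⟨C₁ * (‖X‖ + 1) * C₂, c₁ + c₂, by positivity, by positivity, fun t ht => ?_⟩
  calc ‖covIntegrand X B t‖
      ≤ ‖NormedSpace.exp (t • B)‖ * ‖X‖ * ‖NormedSpace.exp (t • Bᵀ)‖ :=
        (norm_mul_le _ _).trans (by gcongr; exact norm_mul_le _ _)
    _ ≤ (C₁ * Real.exp (-c₁ * t)) * (‖X‖ + 1) * (C₂ * Real.exp (-c₂ * t)) := by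
        gcongr
        · exact h₁ t ht
        · linarith
        · exact h₂ t ht
    _ = C₁ * (‖X‖ + 1) * C₂ * (Real.exp (-c₁ * t) * Real.exp (-c₂ * t)) := by ring
    _ = _ := by rw [← Real.exp_add]; congr 2; ring

lemma tendsto_covIntegrand (hn : 1 ≤ n) {B : Matrix (Fin n) (Fin n) ℝ} (hB : IsStable B)
    (X : Matrix (Fin n) (Fin n) ℝ) : Tendsto (covIntegrand X B) atTop (𝓝 0) := by
  obtain ⟨C, c, hC, hc, h⟩ := exists_norm_covIntegrand_le hn hB X
  refine squeeze_zero_norm' (eventually_atTop.2 ⟨0, h⟩) ?_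
  have h1 : Tendsto (fun t : ℝ => Real.exp (-c * t)) atTop (𝓝 0) := by
    refine Real.tendsto_exp_atBot.comp ?_
    exact tendsto_id.const_mul_atTop_of_neg (by linarith)
  simpa using h1.const_mul C

lemma continuous_entry {M : ℝ → Matrix (Fin n) (Fin n) ℝ} (h : Continuous M) (i j : Fin n) :
    Continuous fun s => M s i j :=
  h.matrix_elem i j

lemma integrableOn_covIntegrand (hn : 1 ≤ n) {B : Matrix (Fin n) (Fin n) ℝ} (hB : IsStable B)
    (X : Matrix (Fin n) (Fin n) ℝ) (i j : Fin n) :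
    IntegrableOn (fun s => covIntegrand X B s i j) (Ioi 0) := by
  obtain ⟨C, c, hC, hc, h⟩ := exists_norm_covIntegrand_le hn hB X
  refine ((integrableOn_exp_mul_Ioi (a := -c) (by linarith) 0).const_mul C).mono'
    (continuous_entry (continuous_covIntegrand X B) i j).aestronglyMeasurable ?_
  refine (ae_restrict_iff' measurableSet_Ioi).2 (Eventually.of_forall fun s hs => ?_)
  exact (abs_entry_le_norm _ i j).trans (h s (le_of_lt hs))

/-- The Lyapunov equation for the stationary covariance. -/
lemma lyapunov_Qinf (hn : 1 ≤ n) (Q : Matrix (Fin n) (Fin n) ℝ)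
    {B : Matrix (Fin n) (Fin n) ℝ} (hB : IsStable B) :
    B * Qinf Q B + Qinf Q B * Bᵀ = -Q := by
  have hint := integrableOn_covIntegrand hn hB Q
  ext i j
  have h1 := integral_Ioi_of_hasDerivAt_of_tendsto (a := (0 : ℝ))
    (f := fun s => covIntegrand Q B s i j)
    (f' := fun s => covIntegrand (B * Q + Q * Bᵀ) B s i j) (m := 0)
    (continuous_entry (continuous_covIntegrand Q B) i j).continuousWithinAt
    (fun s _ => hasDerivAt_entry (hasDerivAt_covIntegrand Q B s) i j)
    (integrableOn_covIntegrand hn hB _ i j)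
    (by
      have := (((continuous_id.matrix_elem i j).tendsto
        (0 : Matrix (Fin n) (Fin n) ℝ))).comp (tendsto_covIntegrand hn hB Q)
      simpa [Function.comp_def] using this)
  simp only [covIntegrand_zero, zero_sub, covIntegrand_lyapunov, Matrix.add_apply,
    Matrix.mul_apply] at h1
  rw [integral_add, integral_finsetSum, integral_finsetSum] at h1
  · simp only [integral_const_mul, integral_mul_const] at h1
    simpa only [Matrix.add_apply, Matrix.mul_apply, Qinf, Matrix.of_apply, Matrix.neg_apply]
      using h1
  · exact fun k _ => (hint i k).mul_const _
  · exact fun k _ => (hint k j).const_mul _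
  · exact integrable_finsetSum _ fun k _ => (hint k j).const_mul _
  · exact integrable_finsetSum _ fun k _ => (hint i k).mul_const _

lemma hasDerivAt_covIntegrand_Qinf (hn : 1 ≤ n) (Q : Matrix (Fin n) (Fin n) ℝ)
    {B : Matrix (Fin n) (Fin n) ℝ} (hB : IsStable B) (s : ℝ) :
    HasDerivAt (covIntegrand (Qinf Q B) B) (-covIntegrand Q B s) s := by
  have h := hasDerivAt_covIntegrand (Qinf Q B) B s
  rwa [lyapunov_Qinf hn Q hB, covIntegrand_neg] at h

lemma Qt_eq (hn : 1 ≤ n) (Q : Matrix (Fin n) (Fin n) ℝ)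
    {B : Matrix (Fin n) (Fin n) ℝ} (hB : IsStable B) {t : ℝ} (ht : 0 ≤ t) :
    Qt Q B t = Qinf Q B - covIntegrand (Qinf Q B) B t := by
  ext i j
  have h := intervalIntegral.integral_eq_sub_of_hasDerivAt (a := 0) (b := t)
    (f := fun s => covIntegrand (Qinf Q B) B s i j) (f' := fun s => -covIntegrand Q B s i j)
    (fun s _ => hasDerivAt_entry (hasDerivAt_covIntegrand_Qinf hn Q hB s) i j)
    ((continuous_entry (continuous_covIntegrand Q B) i j).neg.intervalIntegrable _ _)
  rw [intervalIntegral.integral_neg, intervalIntegral.integral_of_le ht] at h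
  simp only [covIntegrand_zero] at h
  simp only [Qt, Matrix.of_apply, Matrix.sub_apply]
  linarith

lemma Qinf_transpose {Q : Matrix (Fin n) (Fin n) ℝ} (hQ : Q.PosDef)
    (B : Matrix (Fin n) (Fin n) ℝ) : (Qinf Q B)ᵀ = Qinf Q B := by
  have hQT : Qᵀ = Q := by
    have := hQ.1
    rwa [Matrix.IsHermitian, Matrix.conjTranspose_eq_transpose_of_trivial] at this
  ext i j
  simp only [Matrix.transpose_apply, Qinf, Matrix.of_apply]
  congr 1; ext s
  exact congrFun (congrFun (covIntegrand_transpose (B := B) hQT s) i) j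

lemma dotProduct_covIntegrand (X B : Matrix (Fin n) (Fin n) ℝ) (s : ℝ) (x : Fin n → ℝ) :
    x ⬝ᵥ (covIntegrand X B s *ᵥ x) =
      (NormedSpace.exp (s • Bᵀ) *ᵥ x) ⬝ᵥ (X *ᵥ (NormedSpace.exp (s • Bᵀ) *ᵥ x)) := by
  rw [covIntegrand, Matrix.mul_assoc, ← Matrix.mulVec_mulVec, ← Matrix.mulVec_mulVec,
    Matrix.dotProduct_mulVec]
  congr 1
  rw [exp_smul_transpose, Matrix.mulVec_transpose]

lemma exp_smul_mulVec_ne_zero (B : Matrix (Fin n) (Fin n) ℝ) (s : ℝ) {x : Fin n → ℝ}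
    (hx : x ≠ 0) : NormedSpace.exp (s • B) *ᵥ x ≠ 0 := by
  intro h
  apply hx
  have := congrArg (NormedSpace.exp ((-s) • B) *ᵥ ·) h
  simp only [Matrix.mulVec_mulVec, Matrix.mulVec_zero] at this
  have h2 := exp_smul_mul_exp_neg_smul B (-s)
  rw [neg_neg] at h2
  rwa [h2, Matrix.one_mulVec] at this

lemma dotProduct_pos {M : Matrix (Fin n) (Fin n) ℝ} (hM : M.PosDef) {x : Fin n → ℝ}
    (hx : x ≠ 0) : 0 < x ⬝ᵥ (M *ᵥ x) := by
  simpa using hM.dotProduct_mulVec_pos hx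

lemma dotProduct_nonneg {M : Matrix (Fin n) (Fin n) ℝ} (hM : M.PosDef) (x : Fin n → ℝ) :
    0 ≤ x ⬝ᵥ (M *ᵥ x) := by
  rcases eq_or_ne x 0 with rfl | hx
  · simp
  · exact (dotProduct_pos hM hx).le

lemma posDef_of_forall {M : Matrix (Fin n) (Fin n) ℝ} (h : Mᵀ = M)
    (hx : ∀ x, x ≠ 0 → 0 < x ⬝ᵥ (M *ᵥ x)) : M.PosDef :=
  Matrix.PosDef.of_dotProduct_mulVec_pos (by simpa [Matrix.IsHermitian] using h)
    fun x hx0 => by simpa using hx x hx0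

lemma hasDerivAt_form_covIntegrand_Qinf (hn : 1 ≤ n) (Q : Matrix (Fin n) (Fin n) ℝ)
    {B : Matrix (Fin n) (Fin n) ℝ} (hB : IsStable B) (x : Fin n → ℝ) (s : ℝ) :
    HasDerivAt (fun s => x ⬝ᵥ (covIntegrand (Qinf Q B) B s *ᵥ x))
      (-(x ⬝ᵥ (covIntegrand Q B s *ᵥ x))) s := by
  refine (hasDerivAt_matrix_form (hasDerivAt_covIntegrand_Qinf hn Q hB s) x x).congr_deriv ?_
  rw [Matrix.neg_mulVec, dotProduct_neg]

lemma strictAnti_form_covIntegrand (hn : 1 ≤ n) {Q : Matrix (Fin n) (Fin n) ℝ} (hQ : Q.PosDef)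
    {B : Matrix (Fin n) (Fin n) ℝ} (hB : IsStable B) {x : Fin n → ℝ} (hx : x ≠ 0) :
    StrictAnti fun s => x ⬝ᵥ (covIntegrand (Qinf Q B) B s *ᵥ x) := by
  refine strictAnti_of_hasDerivAt_neg
    (fun s => hasDerivAt_form_covIntegrand_Qinf hn Q hB x s) fun s => ?_
  rw [dotProduct_covIntegrand, neg_lt_zero]
  exact dotProduct_pos hQ (exp_smul_mulVec_ne_zero _ _ hx)

lemma posDef_Qinf (hn : 1 ≤ n) {Q : Matrix (Fin n) (Fin n) ℝ} (hQ : Q.PosDef)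
    {B : Matrix (Fin n) (Fin n) ℝ} (hB : IsStable B) : (Qinf Q B).PosDef := by
  refine posDef_of_forall (Qinf_transpose hQ B) fun x hx => ?_
  have hanti := strictAnti_form_covIntegrand hn hQ hB hx
  have hlim : Tendsto (fun s => x ⬝ᵥ (covIntegrand (Qinf Q B) B s *ᵥ x)) atTop (𝓝 0) := by
    have hc : Continuous fun M : Matrix (Fin n) (Fin n) ℝ => x ⬝ᵥ (M *ᵥ x) := by fun_prop
    simpa [Function.comp_def] using (hc.tendsto 0).comp (tendsto_covIntegrand hn hB (Qinf Q B))
  have h1 := hanti.antitone.le_of_tendsto hlim 1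
  have h2 := hanti (zero_lt_one (α := ℝ))
  simp only [covIntegrand_zero] at h2
  exact h1.trans_lt h2

lemma posDef_Qt (hn : 1 ≤ n) {Q : Matrix (Fin n) (Fin n) ℝ} (hQ : Q.PosDef)
    {B : Matrix (Fin n) (Fin n) ℝ} (hB : IsStable B) {t : ℝ} (ht : 0 < t) :
    (Qt Q B t).PosDef := by
  rw [Qt_eq hn Q hB ht.le]
  refine posDef_of_forall ?_ fun x hx => ?_
  · rw [Matrix.transpose_sub, covIntegrand_transpose (Qinf_transpose hQ B), Qinf_transpose hQ B]
  · have h2 := strictAnti_form_covIntegrand hn hQ hB hx ht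
    simp only [covIntegrand_zero] at h2
    rw [Matrix.sub_mulVec, dotProduct_sub]
    linarith

end Covariance

/-! ### Positive definite quadratic forms -/

section Forms

attribute [local instance] Matrix.linftyOpNormedRing Matrix.linftyOpNormedAlgebra

lemma abs_dotProduct_le (x y : Fin n → ℝ) : |x ⬝ᵥ y| ≤ n * (‖x‖ * ‖y‖) := by
  rw [dotProduct]
  refine (Finset.abs_sum_le_sum_abs _ _).trans ?_
  have : ∀ i ∈ (Finset.univ : Finset (Fin n)), |x i * y i| ≤ ‖x‖ * ‖y‖ := fun i _ => by
    rw [abs_mul]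
    exact mul_le_mul (norm_le_pi_norm x i) (norm_le_pi_norm y i) (abs_nonneg _) (norm_nonneg _)
  simpa using Finset.sum_le_card_nsmul _ _ _ this

lemma abs_form_le (A : Matrix (Fin n) (Fin n) ℝ) (x y : Fin n → ℝ) :
    |x ⬝ᵥ (A *ᵥ y)| ≤ n * ‖A‖ * (‖x‖ * ‖y‖) := by
  calc |x ⬝ᵥ (A *ᵥ y)| ≤ n * (‖x‖ * ‖A *ᵥ y‖) := abs_dotProduct_le _ _
    _ ≤ n * (‖x‖ * (‖A‖ * ‖y‖)) := by gcongr; exact Matrix.linfty_opNorm_mulVec A y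
    _ = _ := by ring

lemma form_comm {P : Matrix (Fin n) (Fin n) ℝ} (hP : Pᵀ = P) (x y : Fin n → ℝ) :
    x ⬝ᵥ (P *ᵥ y) = y ⬝ᵥ (P *ᵥ x) := by
  rw [Matrix.dotProduct_mulVec, ← Matrix.mulVec_transpose, hP, dotProduct_comm]

lemma transpose_eq_of_posDef {P : Matrix (Fin n) (Fin n) ℝ} (hP : P.PosDef) : Pᵀ = P := by
  have := hP.1
  rwa [Matrix.IsHermitian, Matrix.conjTranspose_eq_transpose_of_trivial] at this

lemma form_add_smul {P : Matrix (Fin n) (Fin n) ℝ} (hP : Pᵀ = P) (x y : Fin n → ℝ) (t : ℝ) :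
    (x + t • y) ⬝ᵥ (P *ᵥ (x + t • y)) =
      (y ⬝ᵥ (P *ᵥ y)) * (t * t) + (2 * (x ⬝ᵥ (P *ᵥ y))) * t + x ⬝ᵥ (P *ᵥ x) := by
  simp only [Matrix.mulVec_add, Matrix.mulVec_smul, dotProduct_add, add_dotProduct,
    smul_dotProduct, dotProduct_smul, smul_eq_mul, form_comm hP y x]
  ring

lemma form_cauchy_schwarz {P : Matrix (Fin n) (Fin n) ℝ} (hP : P.PosDef) (x y : Fin n → ℝ) :
    (x ⬝ᵥ (P *ᵥ y)) ^ 2 ≤ (x ⬝ᵥ (P *ᵥ x)) * (y ⬝ᵥ (P *ᵥ y)) := by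
  have h := discrim_le_zero (a := y ⬝ᵥ (P *ᵥ y)) (b := 2 * (x ⬝ᵥ (P *ᵥ y)))
    (c := x ⬝ᵥ (P *ᵥ x)) fun t => by
      rw [← form_add_smul (transpose_eq_of_posDef hP)]
      exact dotProduct_nonneg hP _
  rw [discrim] at h
  nlinarith

/-- The norm `x ↦ (⟨P x, x⟩ / 2) ^ (1 / 2)` of a positive definite matrix `P`. -/
noncomputable def formNorm {P : Matrix (Fin n) (Fin n) ℝ} (hP : P.PosDef) :
    Seminorm ℝ (Fin n → ℝ) :=
  Seminorm.of (fun x => √(1 / 2 * (x ⬝ᵥ (P *ᵥ x))))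
    (fun x y => by
      have hx := dotProduct_nonneg hP x
      have hy := dotProduct_nonneg hP y
      refine Real.sqrt_le_iff.2 ⟨by positivity, ?_⟩
      have h1 := form_add_smul (transpose_eq_of_posDef hP) x y 1
      rw [one_smul] at h1
      have h2 : x ⬝ᵥ (P *ᵥ y) ≤
          2 * (√(1 / 2 * (x ⬝ᵥ (P *ᵥ x))) * √(1 / 2 * (y ⬝ᵥ (P *ᵥ y)))) := by
        rw [← Real.sqrt_mul (by positivity)]
        have h3 := Real.abs_le_sqrt (form_cauchy_schwarz hP x y)
        have h4 : √((x ⬝ᵥ (P *ᵥ x)) * (y ⬝ᵥ (P *ᵥ y))) =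
            2 * √(1 / 2 * (x ⬝ᵥ (P *ᵥ x)) * (1 / 2 * (y ⬝ᵥ (P *ᵥ y)))) := by
          have : (x ⬝ᵥ (P *ᵥ x)) * (y ⬝ᵥ (P *ᵥ y)) =
            2 ^ 2 * (1 / 2 * (x ⬝ᵥ (P *ᵥ x)) * (1 / 2 * (y ⬝ᵥ (P *ᵥ y)))) := by ring
          rw [this, Real.sqrt_mul (by norm_num), Real.sqrt_sq (by norm_num)]
        rw [← h4]
        exact (le_abs_self _).trans h3
      have h5 := Real.sq_sqrt (x := 1 / 2 * (x ⬝ᵥ (P *ᵥ x))) (by positivity)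
      have h6 := Real.sq_sqrt (x := 1 / 2 * (y ⬝ᵥ (P *ᵥ y))) (by positivity)
      rw [h1]
      nlinarith)
    (fun a x => by
      have : 1 / 2 * ((a • x) ⬝ᵥ (P *ᵥ (a • x))) = a ^ 2 * (1 / 2 * (x ⬝ᵥ (P *ᵥ x))) := by
        simp only [Matrix.mulVec_smul, smul_dotProduct, dotProduct_smul, smul_eq_mul]
        ring
      rw [this, Real.sqrt_mul (sq_nonneg a), Real.sqrt_sq_eq_abs, Real.norm_eq_abs])

lemma formNorm_sq {P : Matrix (Fin n) (Fin n) ℝ} (hP : P.PosDef) (x : Fin n → ℝ) :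
    formNorm hP x ^ 2 = 1 / 2 * (x ⬝ᵥ (P *ᵥ x)) :=
  Real.sq_sqrt (mul_nonneg (by norm_num) (dotProduct_nonneg hP x))

lemma exists_sq_norm_le_form {P : Matrix (Fin n) (Fin n) ℝ} (hP : P.PosDef) :
    ∃ c : ℝ, 0 < c ∧ ∀ x : Fin n → ℝ, c * ‖x‖ ^ 2 ≤ x ⬝ᵥ (P *ᵥ x) := by
  have hcont : Continuous fun x : Fin n → ℝ => x ⬝ᵥ (P *ᵥ x) := by fun_prop
  rcases (Metric.sphere (0 : Fin n → ℝ) 1).eq_empty_or_nonempty with he | hne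
  · refine ⟨1, one_pos, fun x => ?_⟩
    have hx : x = 0 := by
      by_contra hx
      have : ‖x‖⁻¹ • x ∈ Metric.sphere (0 : Fin n → ℝ) 1 := by
        simp [norm_smul, norm_ne_zero_iff.2 hx]
      rw [he] at this
      exact this
    simp [hx]
  · obtain ⟨y, hy, hmin⟩ := (isCompact_sphere (0 : Fin n → ℝ) 1).exists_isMinOn hne
      hcont.continuousOn
    have hy0 : y ≠ 0 := by
      rintro rfl
      simp at hy
    refine ⟨y ⬝ᵥ (P *ᵥ y), dotProduct_pos hP hy0, fun x => ?_⟩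
    rcases eq_or_ne x 0 with rfl | hx
    · simp
    have hx' : 0 < ‖x‖ := norm_pos_iff.2 hx
    have h1 : ‖x‖⁻¹ • x ∈ Metric.sphere (0 : Fin n → ℝ) 1 := by
      simp [norm_smul, hx'.ne']
    have h2 : y ⬝ᵥ (P *ᵥ y) ≤ (‖x‖⁻¹ • x) ⬝ᵥ (P *ᵥ (‖x‖⁻¹ • x)) := hmin h1
    simp only [Matrix.mulVec_smul, smul_dotProduct, dotProduct_smul, smul_eq_mul] at h2
    calc (y ⬝ᵥ (P *ᵥ y)) * ‖x‖ ^ 2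
        ≤ (‖x‖⁻¹ * (‖x‖⁻¹ * (x ⬝ᵥ (P *ᵥ x)))) * ‖x‖ ^ 2 := by gcongr
      _ = _ := by field_simp

lemma exists_norm_le_formNorm {P : Matrix (Fin n) (Fin n) ℝ} (hP : P.PosDef) :
    ∃ c : ℝ, 0 < c ∧ ∀ x : Fin n → ℝ, c * ‖x‖ ≤ formNorm hP x := by
  obtain ⟨c, hc, h⟩ := exists_sq_norm_le_form hP
  refine ⟨√(c / 2), by positivity, fun x => ?_⟩
  refine le_of_sq_le_sq ?_ (apply_nonneg _ _)
  rw [mul_pow, Real.sq_sqrt (by positivity), formNorm_sq]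
  linarith [h x]

lemma exists_form_le_form {P : Matrix (Fin n) (Fin n) ℝ} (hP : P.PosDef)
    (A : Matrix (Fin n) (Fin n) ℝ) :
    ∃ C : ℝ, 0 < C ∧ ∀ x : Fin n → ℝ, x ⬝ᵥ (A *ᵥ x) ≤ C * (x ⬝ᵥ (P *ᵥ x)) := by
  obtain ⟨c, hc, h⟩ := exists_sq_norm_le_form hP
  refine ⟨(n * ‖A‖ + 1) / c, by positivity, fun x => ?_⟩
  calc x ⬝ᵥ (A *ᵥ x) ≤ n * ‖A‖ * (‖x‖ * ‖x‖) := (le_abs_self _).trans (abs_form_le A x x)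
    _ ≤ (n * ‖A‖ + 1) * ‖x‖ ^ 2 := by nlinarith [sq_nonneg ‖x‖]
    _ = (n * ‖A‖ + 1) / c * (c * ‖x‖ ^ 2) := by field_simp
    _ ≤ _ := by gcongr; exact h x

end Forms

/-! ### The Mehler kernel along backward orbits -/

section Kernel

attribute [local instance] Matrix.linftyOpNormedRing Matrix.linftyOpNormedAlgebra

variable {Q B : Matrix (Fin n) (Fin n) ℝ}

lemma Qinf_mul_inv (hn : 1 ≤ n) (hQ : Q.PosDef) (hB : IsStable B) :
    Qinf Q B * (Qinf Q B)⁻¹ = 1 :=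
  Matrix.mul_nonsing_inv _ (posDef_Qinf hn hQ hB).det_pos.ne'.isUnit

lemma Qinf_inv_mul (hn : 1 ≤ n) (hQ : Q.PosDef) (hB : IsStable B) :
    (Qinf Q B)⁻¹ * Qinf Q B = 1 :=
  Matrix.nonsing_inv_mul _ (posDef_Qinf hn hQ hB).det_pos.ne'.isUnit

lemma Qinf_inv_transpose (hQ : Q.PosDef) : ((Qinf Q B)⁻¹)ᵀ = (Qinf Q B)⁻¹ := by
  rw [Matrix.transpose_nonsing_inv, Qinf_transpose hQ]

lemma D_zero (hn : 1 ≤ n) (hQ : Q.PosDef) (hB : IsStable B) : D Q B 0 = 1 := by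
  simp [D, Qinf_mul_inv hn hQ hB]

lemma D_add (hn : 1 ≤ n) (hQ : Q.PosDef) (hB : IsStable B) (s t : ℝ) :
    D Q B (s + t) = D Q B s * D Q B t := by
  rw [D, D, D, neg_add, exp_smul_add]
  simp only [Matrix.mul_assoc]
  rw [← Matrix.mul_assoc (Qinf Q B)⁻¹ (Qinf Q B), Qinf_inv_mul hn hQ hB, Matrix.one_mul]

lemma D_transpose (hQ : Q.PosDef) (t : ℝ) :
    (D Q B t)ᵀ = (Qinf Q B)⁻¹ * NormedSpace.exp ((-t) • B) * Qinf Q B := by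
  rw [D, Matrix.transpose_mul, Matrix.transpose_mul, exp_smul_transpose,
    Matrix.transpose_transpose, Qinf_inv_transpose hQ, Qinf_transpose hQ, Matrix.mul_assoc]

/-- The matrix `Q_∞⁻¹ + e^{tB*} Q_t⁻¹ e^{tB}` of the quadratic form in the exponent of the Mehler
kernel, when that form is evaluated at `x - D_{-t} u`. -/
noncomputable def mehlerForm (Q B : Matrix (Fin n) (Fin n) ℝ) (t : ℝ) :
    Matrix (Fin n) (Fin n) ℝ :=
  (Qinf Q B)⁻¹ + NormedSpace.exp (t • Bᵀ) * (Qt Q B t)⁻¹ * NormedSpace.exp (t • B)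

lemma D_transpose_mul_mul (hn : 1 ≤ n) (hQ : Q.PosDef) (hB : IsStable B) {t : ℝ} (ht : 0 < t) :
    (D Q B t)ᵀ * (((Qt Q B t)⁻¹ - (Qinf Q B)⁻¹) * D Q B t) = mehlerForm Q B t := by
  have hu := (posDef_Qt hn hQ hB ht).det_pos.ne'.isUnit
  have h1 : (Qt Q B t)⁻¹ * Qt Q B t = 1 := Matrix.nonsing_inv_mul _ hu
  have h1' : Qt Q B t * (Qt Q B t)⁻¹ = 1 := Matrix.mul_nonsing_inv _ hu
  have h2 := Qinf_mul_inv hn hQ hB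
  have h3 := Qinf_inv_mul hn hQ hB
  have hE : NormedSpace.exp (t • Bᵀ) * NormedSpace.exp ((-t) • Bᵀ) = 1 :=
    exp_smul_mul_exp_neg_smul _ t
  have hF : NormedSpace.exp ((-t) • B) * NormedSpace.exp (t • B) = 1 := by
    have := exp_smul_mul_exp_neg_smul B (-t)
    rwa [neg_neg] at this
  have hQ' : Qinf Q B = Qt Q B t + covIntegrand (Qinf Q B) B t := by
    rw [Qt_eq hn Q hB ht.le]; abel
  have hdiff : (Qt Q B t)⁻¹ - (Qinf Q B)⁻¹ =
      (Qt Q B t)⁻¹ * covIntegrand (Qinf Q B) B t * (Qinf Q B)⁻¹ := by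
    have : covIntegrand (Qinf Q B) B t = Qinf Q B - Qt Q B t := by
      rw [Qt_eq hn Q hB ht.le]; abel
    rw [this, Matrix.mul_sub, Matrix.sub_mul, h1, Matrix.one_mul, Matrix.mul_assoc, h2,
      Matrix.mul_one]
  have hA : ((Qt Q B t)⁻¹ - (Qinf Q B)⁻¹) * D Q B t =
      (Qt Q B t)⁻¹ * NormedSpace.exp (t • B) := by
    rw [hdiff, D, covIntegrand]
    calc _ = (Qt Q B t)⁻¹ * NormedSpace.exp (t • B) * Qinf Q B * NormedSpace.exp (t • Bᵀ) *
          ((Qinf Q B)⁻¹ * Qinf Q B) * NormedSpace.exp ((-t) • Bᵀ) * (Qinf Q B)⁻¹ := by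
          simp only [Matrix.mul_assoc]
      _ = (Qt Q B t)⁻¹ * NormedSpace.exp (t • B) * (Qinf Q B *
          ((NormedSpace.exp (t • Bᵀ) * NormedSpace.exp ((-t) • Bᵀ)) * (Qinf Q B)⁻¹)) := by
          rw [h3, Matrix.mul_one]; simp only [Matrix.mul_assoc]
      _ = _ := by rw [hE, Matrix.one_mul, h2, Matrix.mul_one]
  rw [hA, D_transpose hQ, mehlerForm]
  set E := NormedSpace.exp (t • B)
  set E' := NormedSpace.exp (t • Bᵀ)
  set F := NormedSpace.exp ((-t) • B)
  set P := (Qinf Q B)⁻¹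
  set S := (Qt Q B t)⁻¹
  calc P * F * Qinf Q B * (S * E)
      = P * F * (Qt Q B t + E * Qinf Q B * E') * (S * E) := by
        conv_lhs => rw [hQ']
        rfl
    _ = P * F * (Qt Q B t * S) * E + P * (F * E) * Qinf Q B * E' * S * E := by
        simp only [Matrix.mul_add, Matrix.add_mul, Matrix.mul_assoc]
    _ = P + E' * S * E := by
        rw [h1', hF, Matrix.mul_one, Matrix.mul_one, Matrix.mul_assoc P F E, hF, Matrix.mul_one,
          h3, Matrix.one_mul]

lemma R_eq (Q B : Matrix (Fin n) (Fin n) ℝ) (x : Fin n → ℝ) :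
    R Q B x = 1 / 2 * (x ⬝ᵥ ((Qinf Q B)⁻¹ *ᵥ x)) := by
  rw [R, dotProduct_comm]

/-- The Mehler kernel in terms of the backward orbit `D_{-t} u` of `u`. -/
lemma mehlerKernel_eq (hn : 1 ≤ n) (hQ : Q.PosDef) (hB : IsStable B) {t : ℝ} (ht : 0 < t)
    (x u : Fin n → ℝ) :
    mehlerKernel Q B t x u = √((Qinf Q B).det / (Qt Q B t).det) * Real.exp (R Q B x) *
      Real.exp (-(1 / 2) * ((x - D Q B (-t) *ᵥ u) ⬝ᵥ
        (mehlerForm Q B t *ᵥ (x - D Q B (-t) *ᵥ u)))) := by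
  rw [mehlerKernel]
  congr 3
  set w := x - D Q B (-t) *ᵥ u with hw
  have h1 : u - D Q B t *ᵥ x = D Q B t *ᵥ (-w) := by
    rw [hw, neg_sub, Matrix.mulVec_sub, Matrix.mulVec_mulVec, ← D_add hn hQ hB, add_neg_cancel,
      D_zero hn hQ hB, Matrix.one_mulVec]
  rw [h1, ← D_transpose_mul_mul hn hQ hB ht, Matrix.mulVec_mulVec, Matrix.mulVec_neg,
    Matrix.mulVec_neg, neg_dotProduct_neg, dotProduct_comm, ← Matrix.mulVec_mulVec w (D Q B t)ᵀ,
    Matrix.dotProduct_mulVec w, Matrix.vecMul_transpose]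

lemma form_mehlerForm (hn : 1 ≤ n) (hQ : Q.PosDef) (hB : IsStable B) {t : ℝ} (ht : 0 < t)
    (w : Fin n → ℝ) : R Q B w ≤ 1 / 2 * (w ⬝ᵥ (mehlerForm Q B t *ᵥ w)) := by
  rw [R_eq, mehlerForm, Matrix.add_mulVec, dotProduct_add]
  have h : 0 ≤ w ⬝ᵥ ((NormedSpace.exp (t • Bᵀ) * (Qt Q B t)⁻¹ * NormedSpace.exp (t • B)) *ᵥ w) := by
    rw [exp_smul_transpose, Matrix.mul_assoc, ← Matrix.mulVec_mulVec, Matrix.dotProduct_mulVec,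
      Matrix.vecMul_transpose, ← Matrix.mulVec_mulVec]
    exact dotProduct_nonneg (posDef_Qt hn hQ hB ht).inv _
  linarith

end Kernel

/-! ### Time derivative of the Mehler kernel -/

section TimeDerivative

attribute [local instance] Matrix.linftyOpNormedRing Matrix.linftyOpNormedAlgebra

variable {Q B : Matrix (Fin n) (Fin n) ℝ}

lemma exists_norm_le_of_tendsto {F : Type*} [NormedAddCommGroup F] {f : ℝ → F} {l : F} {a : ℝ}
    (hf : ContinuousOn f (Ici a)) (hl : Tendsto f atTop (𝓝 l)) :
    ∃ C : ℝ, 0 < C ∧ ∀ t, a ≤ t → ‖f t‖ ≤ C := by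
  obtain ⟨T, hT⟩ := eventually_atTop.1 (hl.norm.eventually_le_const (lt_add_one ‖l‖))
  obtain ⟨K, hK⟩ := (isCompact_Icc (a := a) (b := max a T)).bddAbove_image
    (hf.norm.mono Icc_subset_Ici_self)
  refine ⟨max (‖l‖ + 1) K, lt_max_of_lt_left (by positivity), fun t ht => ?_⟩
  rcases le_total t (max a T) with h | h
  · exact (hK (mem_image_of_mem _ ⟨ht, h⟩)).trans (le_max_right _ _)
  · exact (hT t ((le_max_right _ _).trans h)).trans (le_max_left _ _)

lemma exists_bound_comp {E F : Type*} [NormedAddCommGroup E] [NormedSpace ℝ E]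
    [NormedAddCommGroup F] [NormedSpace ℝ F] {q q' : ℝ → E} {l : E} {C c : ℝ} {Φ : E → F}
    (hd : ∀ t, 1 ≤ t → HasDerivAt q (q' t) t)
    (hq' : ∀ t, 1 ≤ t → ‖q' t‖ ≤ C * Real.exp (-c * t)) (hl : Tendsto q atTop (𝓝 l))
    (hΦ : ∀ t, 1 ≤ t → ContDiffAt ℝ 1 Φ (q t)) (hΦl : ContDiffAt ℝ 1 Φ l) :
    ∃ K : ℝ, 0 < K ∧ ∀ t, 1 ≤ t → ‖Φ (q t)‖ ≤ K ∧
      ∃ d, HasDerivAt (fun s => Φ (q s)) d t ∧ ‖d‖ ≤ K * Real.exp (-c * t) := by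
  obtain ⟨C₁, hC₁, h₁⟩ := exists_norm_le_of_tendsto (a := 1) (f := fun t => Φ (q t))
    (fun t ht => ((hΦ t ht).continuousAt.comp (hd t ht).continuousAt).continuousWithinAt)
    (hΦl.continuousAt.tendsto.comp hl)
  obtain ⟨C₂, hC₂, h₂⟩ := exists_norm_le_of_tendsto (a := 1) (f := fun t => fderiv ℝ Φ (q t))
    (fun t ht => (ContinuousAt.comp (f := q) ((hΦ t ht).continuousAt_fderiv one_ne_zero)
      (hd t ht).continuousAt).continuousWithinAt)
    ((hΦl.continuousAt_fderiv one_ne_zero).tendsto.comp hl)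
  refine ⟨max C₁ (C₂ * C), lt_max_of_lt_left hC₁, fun t ht => ⟨?_, ?_⟩⟩
  · exact (h₁ t ht).trans (le_max_left _ _)
  · refine ⟨fderiv ℝ Φ (q t) (q' t), ?_, ?_⟩
    · exact (((hΦ t ht).differentiableAt one_ne_zero).hasFDerivAt).comp_hasDerivAt t (hd t ht)
    · calc ‖fderiv ℝ Φ (q t) (q' t)‖ ≤ ‖fderiv ℝ Φ (q t)‖ * ‖q' t‖ :=
          ContinuousLinearMap.le_opNorm _ _
        _ ≤ C₂ * (C * Real.exp (-c * t)) := by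
          gcongr
          · exact h₂ t ht
          · exact hq' t ht
        _ = C₂ * C * Real.exp (-c * t) := by ring
        _ ≤ _ := by gcongr; exact le_max_right _ _

/-- A `C¹` function of `Q_t` is bounded for `t ≥ 1` and has an exponentially decaying derivative,
because `Q_t` converges exponentially to the positive definite matrix `Q_∞`. -/
lemma exists_bound_comp_Qt {F : Type*} [NormedAddCommGroup F] [NormedSpace ℝ F]
    (hn : 1 ≤ n) (hQ : Q.PosDef) (hB : IsStable B)
    {Φ : Matrix (Fin n) (Fin n) ℝ → F} (hΦ : ∀ A, A.PosDef → ContDiffAt ℝ 1 Φ A) :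
    ∃ C c : ℝ, 0 < C ∧ 0 < c ∧ ∀ t, 1 ≤ t → ‖Φ (Qt Q B t)‖ ≤ C ∧
      ∃ d, HasDerivAt (fun s => Φ (Qt Q B s)) d t ∧ ‖d‖ ≤ C * Real.exp (-c * t) := by
  have hev : ∀ t, 0 < t → (fun s => Qinf Q B - covIntegrand (Qinf Q B) B s) =ᶠ[𝓝 t] Qt Q B :=
    fun t ht => by
      filter_upwards [eventually_gt_nhds ht] with s hs
      exact (Qt_eq hn Q hB hs.le).symm
  have hd : ∀ t, 1 ≤ t → HasDerivAt (Qt Q B) (covIntegrand Q B t) t := fun t ht => by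
    have h := (hasDerivAt_covIntegrand_Qinf hn Q hB t).const_sub (Qinf Q B)
    rw [neg_neg] at h
    exact h.congr_of_eventuallyEq (hev t (by linarith)).symm
  have hlim : Tendsto (Qt Q B) atTop (𝓝 (Qinf Q B)) := by
    have h := (tendsto_covIntegrand hn hB (Qinf Q B)).const_sub (Qinf Q B)
    rw [sub_zero] at h
    refine h.congr' ?_
    filter_upwards [eventually_ge_atTop 0] with s hs
    exact (Qt_eq hn Q hB hs).symm
  obtain ⟨C, c, hC, hc, h⟩ := exists_norm_covIntegrand_le hn hB Q
  obtain ⟨K, hK, hK'⟩ := exists_bound_comp hd (fun t ht => h t (by linarith)) hlim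
    (fun t ht => hΦ _ (posDef_Qt hn hQ hB (by linarith))) (hΦ _ (posDef_Qinf hn hQ hB))
  exact ⟨K, c, hK, hc, hK'⟩

lemma contDiff_det : ContDiff ℝ 1 fun A : Matrix (Fin n) (Fin n) ℝ => A.det := by
  have hentry : ∀ i j, ContDiff ℝ 1 fun A : Matrix (Fin n) (Fin n) ℝ => A i j := fun i j =>
    (LinearMap.toContinuousLinearMap (Matrix.entryLinearMap ℝ ℝ i j)).contDiff
  simp only [Matrix.det_apply']
  exact ContDiff.sum fun σ _ => contDiff_const.mul (contDiff_prod fun i _ => hentry _ _)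

lemma exists_bound_det (hn : 1 ≤ n) (hQ : Q.PosDef) (hB : IsStable B) :
    ∃ C c : ℝ, 0 < C ∧ 0 < c ∧ ∀ t, 1 ≤ t → |√((Qinf Q B).det / (Qt Q B t).det)| ≤ C ∧
      ∃ d, HasDerivAt (fun s => √((Qinf Q B).det / (Qt Q B s).det)) d t ∧
        |d| ≤ C * Real.exp (-c * t) := by
  refine exists_bound_comp_Qt hn hQ hB (Φ := fun A => √((Qinf Q B).det / A.det)) fun A hA => ?_
  have h1 := (posDef_Qinf hn hQ hB).det_pos
  have h2 := hA.det_pos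
  exact (contDiffAt_const.div contDiff_det.contDiffAt h2.ne').sqrt (div_pos h1 h2).ne'

lemma exists_bound_inv (hn : 1 ≤ n) (hQ : Q.PosDef) (hB : IsStable B) :
    ∃ C c : ℝ, 0 < C ∧ 0 < c ∧ ∀ t, 1 ≤ t → ‖(Qt Q B t)⁻¹‖ ≤ C ∧
      ∃ d, HasDerivAt (fun s => (Qt Q B s)⁻¹) d t ∧ ‖d‖ ≤ C * Real.exp (-c * t) := by
  refine exists_bound_comp_Qt hn hQ hB (Φ := fun A => A⁻¹) fun A hA => ?_
  simp only [Matrix.nonsing_inv_eq_ringInverse]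
  obtain ⟨u, hu⟩ := (Matrix.isUnit_iff_isUnit_det A).2 hA.det_pos.ne'.isUnit
  rw [← hu]
  exact contDiffAt_ringInverse ℝ u

lemma exp_neg_mul_le_exp_neg_mul {a b t : ℝ} (h : a ≤ b) (ht : 0 ≤ t) :
    Real.exp (-b * t) ≤ Real.exp (-a * t) :=
  Real.exp_le_exp.2 (by nlinarith)

lemma exists_bound_mehlerForm (hn : 1 ≤ n) (hQ : Q.PosDef) (hB : IsStable B) :
    ∃ C c : ℝ, 0 < C ∧ 0 < c ∧ ∀ t, 1 ≤ t → ‖mehlerForm Q B t‖ ≤ C ∧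
      ∃ d, HasDerivAt (fun s => mehlerForm Q B s) d t ∧ ‖d‖ ≤ C * Real.exp (-c * t) := by
  obtain ⟨C₁, c₁, hC₁, hc₁, h₁⟩ := exists_norm_exp_le hn hB
  obtain ⟨C₂, c₂, hC₂, hc₂, h₂⟩ := exists_norm_exp_le hn (isStable_transpose hB)
  obtain ⟨C₃, c₃, hC₃, hc₃, h₃⟩ := exists_bound_inv hn hQ hB
  have hle : ∀ {c t : ℝ}, 0 < c → 1 ≤ t → Real.exp (-c * t) ≤ 1 := fun hc ht =>
    Real.exp_le_one_iff.2 (by nlinarith)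
  have hN : ∀ t, 1 ≤ t → ‖mehlerForm Q B t‖ ≤ ‖(Qinf Q B)⁻¹‖ + C₂ * C₃ * C₁ := fun t ht => by
    refine (norm_add_le _ _).trans ?_
    gcongr
    calc _ ≤ ‖NormedSpace.exp (t • Bᵀ)‖ * ‖(Qt Q B t)⁻¹‖ * ‖NormedSpace.exp (t • B)‖ :=
          (norm_mul_le _ _).trans (by gcongr; exact norm_mul_le _ _)
      _ ≤ C₂ * C₃ * C₁ := by
        gcongr
        · exact (h₂ t (by linarith)).trans (mul_le_of_le_one_right hC₂.le (hle hc₂ ht))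
        · exact (h₃ t ht).1
        · exact (h₁ t (by linarith)).trans (mul_le_of_le_one_right hC₁.le (hle hc₁ ht))
  refine ⟨‖(Qinf Q B)⁻¹‖ + C₂ * C₃ * C₁ + C₂ * C₃ * C₁ * (‖Bᵀ‖ + 1 + ‖B‖), c₁, by positivity, hc₁,
    fun t ht => ⟨(hN t ht).trans (le_add_of_nonneg_right (by positivity)), ?_⟩⟩
  obtain ⟨hb, d, hd, hdb⟩ := h₃ t ht
  have hE' := hasDerivAt_exp_smul_const' Bᵀ t
  have hE := hasDerivAt_exp_smul_const' B t
  have hprod := ((hE'.mul hd).mul hE).const_add (Qinf Q B)⁻¹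
  refine ⟨_, hprod, ?_⟩
  have hE'b : ‖NormedSpace.exp (t • Bᵀ)‖ ≤ C₂ :=
    (h₂ t (by linarith)).trans (mul_le_of_le_one_right hC₂.le (hle hc₂ ht))
  have hdb' : ‖d‖ ≤ C₃ := hdb.trans (mul_le_of_le_one_right hC₃.le (hle hc₃ ht))
  have hEb := h₁ t (by linarith)
  set e := Real.exp (-c₁ * t)
  calc _ ≤ ‖(Bᵀ * NormedSpace.exp (t • Bᵀ) * (Qt Q B t)⁻¹ + NormedSpace.exp (t • Bᵀ) * d) *
          NormedSpace.exp (t • B)‖ + ‖NormedSpace.exp (t • Bᵀ) * (Qt Q B t)⁻¹ *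
          (B * NormedSpace.exp (t • B))‖ := norm_add_le _ _
    _ ≤ (‖Bᵀ‖ * C₂ * C₃ + C₂ * C₃) * (C₁ * e) + C₂ * C₃ * (‖B‖ * (C₁ * e)) := by
      gcongr
      · refine (norm_mul_le _ _).trans ?_
        gcongr
        refine (norm_add_le _ _).trans ?_
        gcongr
        · refine (norm_mul_le _ _).trans ?_
          gcongr
          refine (norm_mul_le _ _).trans ?_
          gcongr
        · refine (norm_mul_le _ _).trans ?_
          gcongr
      · refine (norm_mul_le _ _).trans ?_
        gcongr
        · refine (norm_mul_le _ _).trans ?_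
          gcongr
        · refine (norm_mul_le _ _).trans ?_
          gcongr
    _ = C₂ * C₃ * C₁ * (‖Bᵀ‖ + 1 + ‖B‖) * e := by ring
    _ ≤ _ := by gcongr; exact le_add_of_nonneg_left (by positivity)

/-- The norm on `ℝⁿ` whose square is the quadratic form `R`. -/
noncomputable def gaussNorm (hn : 1 ≤ n) (hQ : Q.PosDef) (hB : IsStable B) :
    Seminorm ℝ (Fin n → ℝ) :=
  formNorm (posDef_Qinf hn hQ hB).inv

lemma gaussNorm_sq (hn : 1 ≤ n) (hQ : Q.PosDef) (hB : IsStable B) (x : Fin n → ℝ) :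
    gaussNorm hn hQ hB x ^ 2 = R Q B x := by
  rw [gaussNorm, formNorm_sq, R_eq]

lemma hasDerivAt_D_neg_mulVec (hn : 1 ≤ n) (hQ : Q.PosDef) (hB : IsStable B) (u : Fin n → ℝ)
    (t : ℝ) : HasDerivAt (fun s => D Q B (-s) *ᵥ u)
      ((Qinf Q B * Bᵀ * (Qinf Q B)⁻¹) *ᵥ (D Q B (-t) *ᵥ u)) t := by
  have h := ((hasDerivAt_exp_smul_const' Bᵀ t).const_mul (Qinf Q B)).mul_const (Qinf Q B)⁻¹
  have h2 := hasDerivAt_linearMap_comp h ((Matrix.mulVecBilin ℝ ℝ).flip u)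
  have h3 : Qinf Q B * (Bᵀ * NormedSpace.exp (t • Bᵀ)) * (Qinf Q B)⁻¹ =
      Qinf Q B * Bᵀ * (Qinf Q B)⁻¹ * D Q B (-t) := by
    rw [D, neg_neg]
    calc _ = Qinf Q B * Bᵀ * 1 * NormedSpace.exp (t • Bᵀ) * (Qinf Q B)⁻¹ := by
          simp only [Matrix.mul_assoc, Matrix.one_mul]
      _ = _ := by rw [← Qinf_inv_mul hn hQ hB]; simp only [Matrix.mul_assoc]
  rw [Matrix.mulVec_mulVec, ← h3]
  simp only [D, neg_neg]
  exact h2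

lemma hasDerivAt_form {M : ℝ → Matrix (Fin n) (Fin n) ℝ} {M' : Matrix (Fin n) (Fin n) ℝ}
    {w : ℝ → Fin n → ℝ} {w' : Fin n → ℝ} {t : ℝ} (hM : HasDerivAt M M' t)
    (hw : HasDerivAt w w' t) :
    HasDerivAt (fun s => w s ⬝ᵥ (M s *ᵥ w s))
      (w' ⬝ᵥ (M t *ᵥ w t) + w t ⬝ᵥ (M' *ᵥ w t) + w t ⬝ᵥ (M t *ᵥ w')) t := by
  have hw' := hasDerivAt_pi.1 hw
  have h := HasDerivAt.fun_sum (u := Finset.univ) fun i _ => (hw' i).mul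
    (HasDerivAt.fun_sum (u := Finset.univ) fun j _ =>
      (hasDerivAt_entry hM i j).mul (hw' j))
  refine h.congr_deriv ?_
  simp only [dotProduct, Matrix.mulVec, Finset.sum_add_distrib, mul_add, Pi.mul_apply]
  ring

lemma mul_exp_neg_le_one (y : ℝ) : y * Real.exp (-y) ≤ 1 := by
  rw [Real.exp_neg, ← div_eq_mul_inv, div_le_one (Real.exp_pos y)]
  linarith [Real.add_one_le_exp y]

/-- The size of the derivative of a product `g X e^{-q/2}`, where `q'` is controlled by a decaying
factor `e` times `y ^ 2` and by the speed `V` times `y`, and where the Gaussian factor `h` absorbs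
the powers of `y`. -/
lemma abs_deriv_product_le {g g' q' X Z H C₁ m C₂ G k L e V y h : ℝ} (hC₁ : 0 ≤ C₁) (hm : 0 ≤ m)
    (hC₂ : 0 ≤ C₂) (hG : 0 ≤ G) (hk : 0 < k) (hL : 0 ≤ L) (he : 0 ≤ e) (hV : 0 ≤ V)
    (hh1 : h ≤ 1) (hy1 : y * h ≤ L) (hy2 : y ^ 2 * h ≤ L) (hX : 0 ≤ X) (hZ : 0 ≤ Z) (hH : 0 ≤ H)
    (hZH : Z ≤ H * h) (hg : |g| ≤ C₁) (hg' : |g'| ≤ C₁ * e)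
    (hq' : |q'| ≤ m * C₂ * e * y ^ 2 + 2 * (m * C₂ * (y * (G * (V / k))))) :
    |g' * X * Z + g * X * (Z * (-(1 / 2) * q'))| ≤
      (C₁ + 1 / 2 * C₁ * m * C₂ * L + C₁ * m * C₂ * G * L / k) * X * (H * (e + V)) := by
  have e1 : g' * X * Z + g * X * (Z * (-(1 / 2) * q')) = X * Z * (g' - 1 / 2 * g * q') := by ring
  have e2 : |g' - 1 / 2 * g * q'| ≤ C₁ * e + 1 / 2 * C₁ *
      (m * C₂ * e * y ^ 2 + 2 * (m * C₂ * (y * (G * (V / k))))) := by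
    refine (abs_sub _ _).trans ?_
    rw [abs_mul, abs_mul, abs_of_pos (by norm_num : (0 : ℝ) < 1 / 2)]
    gcongr
  have e3 : 0 ≤ C₁ * e + 1 / 2 * C₁ * (m * C₂ * e * y ^ 2 + 2 * (m * C₂ * (y * (G * (V / k))))) :=
    (abs_nonneg _).trans e2
  set K₁ := C₁ + 1 / 2 * C₁ * m * C₂ * L with hK₁
  set K₂ := C₁ * m * C₂ * G * L / k with hK₂
  have hK₁0 : 0 ≤ K₁ := by positivity
  have hK₂0 : 0 ≤ K₂ := by positivity
  rw [e1, abs_mul, abs_of_nonneg (mul_nonneg hX hZ)]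
  have e4 : C₁ * h + 1 / 2 * C₁ * m * C₂ * (y ^ 2 * h) ≤ K₁ := by
    rw [hK₁]
    gcongr
    exact mul_le_of_le_one_right hC₁ hh1
  have e5 : C₁ * m * C₂ * G * (y * h) / k ≤ K₂ := by
    rw [hK₂]
    gcongr
  calc X * Z * |g' - 1 / 2 * g * q'|
      ≤ X * (H * h) * (C₁ * e + 1 / 2 * C₁ *
        (m * C₂ * e * y ^ 2 + 2 * (m * C₂ * (y * (G * (V / k)))))) :=
        mul_le_mul (mul_le_mul_of_nonneg_left hZH hX) e2 (abs_nonneg _)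
          (mul_nonneg hX (hZ.trans hZH))
    _ = X * H * ((C₁ * h + 1 / 2 * C₁ * m * C₂ * (y ^ 2 * h)) * e +
        C₁ * m * C₂ * G * (y * h) / k * V) := by ring
    _ ≤ X * H * (K₁ * e + K₂ * V) := by gcongr
    _ ≤ X * H * ((K₁ + K₂) * e + (K₁ + K₂) * V) := by gcongr <;> linarith
    _ = _ := by ring

/-- The Mehler kernel and its time derivative for `t ≥ 1`: the derivative is Gaussian in the
distance of `x` from the backward orbit of `u`, and apart from an exponentially decaying term it
carries as a factor the speed of that orbit. -/
lemma exists_bound_deriv_mehlerKernel (hn : 1 ≤ n) (hQ : Q.PosDef) (hB : IsStable B) :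
    ∃ C c : ℝ, 0 < C ∧ 0 < c ∧ ∀ t, 1 ≤ t → ∀ x u,
      |mehlerKernel Q B t x u| ≤ C * Real.exp (gaussNorm hn hQ hB x ^ 2) ∧
      ∃ d, HasDerivAt (fun s => mehlerKernel Q B s x u) d t ∧
        |d| ≤ C * Real.exp (gaussNorm hn hQ hB x ^ 2) *
          (Real.exp (-(1 / 2) * gaussNorm hn hQ hB (x - D Q B (-t) *ᵥ u) ^ 2) *
          (Real.exp (-c * t) + gaussNorm hn hQ hB (D Q B (-t) *ᵥ u))) := by
  have haux : ∀ y : ℝ, y ≤ 1 + y ^ 2 := fun y => by nlinarith [sq_nonneg (y - 1)]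
  obtain ⟨C₁, c₁, hC₁, hc₁, h₁⟩ := exists_bound_det hn hQ hB
  obtain ⟨C₂, c₂, hC₂, hc₂, h₂⟩ := exists_bound_mehlerForm hn hQ hB
  obtain ⟨k, hk, hN⟩ := exists_norm_le_formNorm (posDef_Qinf hn hQ hB).inv
  change ∀ x, k * ‖x‖ ≤ gaussNorm hn hQ hB x at hN
  set N := gaussNorm hn hQ hB with hNdef
  set G := Qinf Q B * Bᵀ * (Qinf Q B)⁻¹
  set L := 1 + 2 / k ^ 2 with hL
  have hL0 : 0 < L := by positivity
  set K₁ := C₁ + 1 / 2 * C₁ * n * C₂ * L with hK₁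
  set K₂ := C₁ * n * C₂ * ‖G‖ * L / k with hK₂
  have hK₁0 : 0 < K₁ := by positivity
  have hK₂0 : 0 ≤ K₂ := by positivity
  refine ⟨K₁ + K₂, min c₁ c₂, by positivity, lt_min hc₁ hc₂, fun t ht x u => ?_⟩
  have ht0 : 0 < t := by linarith
  set w : ℝ → Fin n → ℝ := fun s => x - D Q B (-s) *ᵥ u with hw
  set v := D Q B (-t) *ᵥ u with hv
  set q : ℝ → ℝ := fun s => w s ⬝ᵥ (mehlerForm Q B s *ᵥ w s) with hq
  obtain ⟨hg, g', hg', hg'b⟩ := h₁ t ht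
  obtain ⟨hM, M', hM', hM'b⟩ := h₂ t ht
  set g : ℝ → ℝ := fun s => √((Qinf Q B).det / (Qt Q B s).det) with hgdef
  change |g t| ≤ C₁ at hg
  have hqR : N (w t) ^ 2 ≤ 1 / 2 * q t := by
    rw [hNdef, gaussNorm_sq]
    exact form_mehlerForm hn hQ hB ht0 (w t)
  have hexp : Real.exp (-(1 / 2) * q t) ≤ Real.exp (-N (w t) ^ 2) :=
    Real.exp_le_exp.2 (by linarith)
  constructor
  · rw [mehlerKernel_eq hn hQ hB ht0, abs_mul, abs_mul, Real.abs_exp, Real.abs_exp,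
      ← gaussNorm_sq hn hQ hB]
    have : Real.exp (-(1 / 2) * q t) ≤ 1 :=
      hexp.trans (Real.exp_le_one_iff.2 (by have := sq_nonneg (N (w t)); linarith))
    calc |g t| * Real.exp (N x ^ 2) * Real.exp (-(1 / 2) * q t)
        ≤ (K₁ + K₂) * Real.exp (N x ^ 2) * 1 := by
          gcongr
          calc |g t| ≤ C₁ := hg
            _ ≤ C₁ + 1 / 2 * C₁ * n * C₂ * L := le_add_of_nonneg_right (by positivity)
            _ ≤ K₁ + K₂ := le_add_of_nonneg_right (by positivity)
      _ = _ := by ring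
  have hwd : HasDerivAt w (-(G *ᵥ v)) t :=
    (hasDerivAt_D_neg_mulVec hn hQ hB u t).const_sub x
  have hqd := hasDerivAt_form hM' hwd
  set q' := (-(G *ᵥ v)) ⬝ᵥ (mehlerForm Q B t *ᵥ w t) + w t ⬝ᵥ (M' *ᵥ w t) +
    w t ⬝ᵥ (mehlerForm Q B t *ᵥ (-(G *ᵥ v))) with hq'
  have hKd : HasDerivAt (fun s => g s * Real.exp (R Q B x) * Real.exp (-(1 / 2) * q s))
      (g' * Real.exp (R Q B x) * Real.exp (-(1 / 2) * q t) +
        g t * Real.exp (R Q B x) * (Real.exp (-(1 / 2) * q t) * (-(1 / 2) * q'))) t :=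
    (hg'.mul_const _).mul ((hqd.const_mul (-(1 / 2))).exp)
  have hKd' : HasDerivAt (fun s => mehlerKernel Q B s x u) _ t :=
    hKd.congr_of_eventuallyEq (by
      filter_upwards [eventually_gt_nhds ht0] with s hs
      exact mehlerKernel_eq hn hQ hB hs x u)
  refine ⟨_, hKd', ?_⟩
  rw [← gaussNorm_sq hn hQ hB]
  set y := ‖w t‖ with hy
  set e := Real.exp (-(min c₁ c₂) * t) with he
  have he1 : Real.exp (-c₁ * t) ≤ e := exp_neg_mul_le_exp_neg_mul (min_le_left _ _) ht0.le
  have he2 : Real.exp (-c₂ * t) ≤ e := exp_neg_mul_le_exp_neg_mul (min_le_right _ _) ht0.le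
  have hGv : ‖-(G *ᵥ v)‖ ≤ ‖G‖ * (N v / k) := by
    rw [norm_neg]
    refine (Matrix.linfty_opNorm_mulVec G v).trans ?_
    gcongr
    rw [le_div_iff₀ hk, mul_comm]
    exact hN v
  have hq'b : |q'| ≤ n * C₂ * e * y ^ 2 + 2 * (n * C₂ * (y * (‖G‖ * (N v / k)))) := by
    have e1 := abs_form_le (mehlerForm Q B t) (-(G *ᵥ v)) (w t)
    have e2 := abs_form_le M' (w t) (w t)
    have e3 := abs_form_le (mehlerForm Q B t) (w t) (-(G *ᵥ v))
    have f1 : n * ‖mehlerForm Q B t‖ * (‖w t‖ * ‖-(G *ᵥ v)‖) ≤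
        n * C₂ * (y * (‖G‖ * (N v / k))) := by gcongr
    have f2 : n * ‖M'‖ * (‖w t‖ * ‖w t‖) ≤ n * C₂ * e * y ^ 2 := by
      have : ‖M'‖ ≤ C₂ * e := hM'b.trans (by gcongr)
      calc n * ‖M'‖ * (‖w t‖ * ‖w t‖) ≤ n * (C₂ * e) * (y * y) := by gcongr
        _ = _ := by ring
    have := (abs_add_le ((-(G *ᵥ v)) ⬝ᵥ (mehlerForm Q B t *ᵥ w t) + w t ⬝ᵥ (M' *ᵥ w t))
      (w t ⬝ᵥ (mehlerForm Q B t *ᵥ (-(G *ᵥ v)))))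
    have := abs_add_le ((-(G *ᵥ v)) ⬝ᵥ (mehlerForm Q B t *ᵥ w t)) (w t ⬝ᵥ (M' *ᵥ w t))
    linarith
  have hhalf : Real.exp (-N (w t) ^ 2) =
      Real.exp (-(1 / 2) * N (w t) ^ 2) * Real.exp (-(1 / 2 * N (w t) ^ 2)) := by
    rw [← Real.exp_add]; congr 1; ring
  set h := Real.exp (-(1 / 2 * N (w t) ^ 2)) with hh
  have hh1 : h ≤ 1 := Real.exp_le_one_iff.2 (by have := sq_nonneg (N (w t)); linarith)
  have hh0 : 0 < h := Real.exp_pos _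
  have hy0 : 0 ≤ y := norm_nonneg _
  have hy2 : y ^ 2 * h ≤ 2 / k ^ 2 := by
    have h1 := mul_exp_neg_le_one (1 / 2 * N (w t) ^ 2)
    have h2 : k ^ 2 * y ^ 2 ≤ N (w t) ^ 2 := by
      rw [← mul_pow]
      exact pow_le_pow_left₀ (by positivity) (hN (w t)) 2
    rw [le_div_iff₀ (by positivity)]
    calc y ^ 2 * h * k ^ 2 = k ^ 2 * y ^ 2 * h := by ring
      _ ≤ N (w t) ^ 2 * h := mul_le_mul_of_nonneg_right h2 hh0.le
      _ = 2 * (1 / 2 * N (w t) ^ 2 * h) := by ring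
      _ ≤ 2 := by linarith
  have hy2L : y ^ 2 * h ≤ L := hy2.trans (by rw [hL]; linarith)
  have hy1L : y * h ≤ L := by
    calc y * h ≤ (1 + y ^ 2) * h := mul_le_mul_of_nonneg_right (haux y) hh0.le
      _ = h + y ^ 2 * h := by ring
      _ ≤ L := by rw [hL]; linarith
  have hNv : 0 ≤ N v := apply_nonneg _ _
  have he0 : 0 < e := Real.exp_pos _
  exact abs_deriv_product_le hC₁.le (Nat.cast_nonneg n) hC₂.le (norm_nonneg G) hk hL0.le he0.le
    hNv hh1 hy1L hy2L (Real.exp_pos _).le (Real.exp_pos _).le (Real.exp_pos _).le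
    (hexp.trans hhalf.le) hg (hg'b.trans (by gcongr)) hq'b

lemma exists_growth_gaussNorm (hn : 1 ≤ n) (hQ : Q.PosDef) (hB : IsStable B) :
    ∃ a b : ℝ, 0 < a ∧ 0 < b ∧ ∀ x s, ∃ r,
      HasDerivAt (fun s => gaussNorm hn hQ hB (D Q B s *ᵥ x) ^ 2) r s ∧
      a * gaussNorm hn hQ hB (D Q B s *ᵥ x) ^ 2 ≤ r ∧
      r ≤ b * gaussNorm hn hQ hB (D Q B s *ᵥ x) ^ 2 := by
  obtain ⟨C, hC, hCle⟩ := exists_form_le_form hQ (Qinf Q B)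
  obtain ⟨b, hb, hble⟩ := exists_form_le_form (posDef_Qinf hn hQ hB) Q
  refine ⟨C⁻¹, b, inv_pos.2 hC, hb, fun x s => ?_⟩
  set z := (Qinf Q B)⁻¹ *ᵥ x with hz
  have hform : ∀ s, gaussNorm hn hQ hB (D Q B s *ᵥ x) ^ 2 =
      1 / 2 * (z ⬝ᵥ (covIntegrand (Qinf Q B) B (-s) *ᵥ z)) := fun s => by
    rw [gaussNorm_sq, R_eq, dotProduct_covIntegrand, D, Matrix.mul_assoc, ← Matrix.mulVec_mulVec,
      ← Matrix.mulVec_mulVec, Matrix.mulVec_mulVec _ (Qinf Q B)⁻¹ (Qinf Q B),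
      Qinf_inv_mul hn hQ hB, Matrix.one_mulVec, dotProduct_comm]
  simp only [hform]
  have hd := ((hasDerivAt_form_covIntegrand_Qinf hn Q hB z (-s)).scomp s
    (hasDerivAt_neg s)).const_mul (1 / 2)
  refine ⟨1 / 2 * (z ⬝ᵥ (covIntegrand Q B (-s) *ᵥ z)), ?_, ?_, ?_⟩
  · refine HasDerivAt.congr_deriv hd ?_
    simp
  · rw [dotProduct_covIntegrand, dotProduct_covIntegrand]
    have := hCle (NormedSpace.exp ((-s) • Bᵀ) *ᵥ z)
    rw [inv_mul_le_iff₀ hC]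
    linarith
  · rw [dotProduct_covIntegrand, dotProduct_covIntegrand]
    have := hble (NormedSpace.exp ((-s) • Bᵀ) *ᵥ z)
    linarith

lemma continuous_D (Q B : Matrix (Fin n) (Fin n) ℝ) : Continuous (D Q B) := by
  have h : Continuous fun s : ℝ => NormedSpace.exp (s • Bᵀ) :=
    continuous_iff_continuousAt.2 fun s => (hasDerivAt_exp_smul_const Bᵀ s).continuousAt
  exact (continuous_const.mul (h.comp continuous_neg)).mul continuous_const

end TimeDerivative

/-! ### Expanding flows and integrals along orbits -/

/-- A linear flow `D` on `ℝⁿ` along which the square of the norm `N` grows exponentially, at a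
rate between `a` and `b`. -/
structure IsExpandingFlow (N : Seminorm ℝ (Fin n → ℝ)) (D : ℝ → Matrix (Fin n) (Fin n) ℝ)
    (a b : ℝ) : Prop where
  a_pos : 0 < a
  b_pos : 0 < b
  lower : ∃ c : ℝ, 0 < c ∧ ∀ x, c * ‖x‖ ≤ N x
  continuous_norm : Continuous N
  zero : D 0 = 1
  add : ∀ s t, D (s + t) = D s * D t
  continuous_flow : Continuous D
  growth : ∀ x s, ∃ r, HasDerivAt (fun s => N (D s *ᵥ x) ^ 2) r s ∧
    a * N (D s *ᵥ x) ^ 2 ≤ r ∧ r ≤ b * N (D s *ᵥ x) ^ 2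

namespace IsExpandingFlow

variable {N : Seminorm ℝ (Fin n → ℝ)} {D : ℝ → Matrix (Fin n) (Fin n) ℝ} {a b : ℝ}

lemma norm_pos (h : IsExpandingFlow N D a b) {x : Fin n → ℝ} (hx : x ≠ 0) : 0 < N x := by
  obtain ⟨c, hc, hN⟩ := h.lower
  exact lt_of_lt_of_le (mul_pos hc (norm_pos_iff.2 hx)) (hN x)

lemma mulVec_add (h : IsExpandingFlow N D a b) (s t : ℝ) (x : Fin n → ℝ) :
    D (s + t) *ᵥ x = D s *ᵥ (D t *ᵥ x) := by
  rw [h.add, Matrix.mulVec_mulVec]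

lemma mulVec_neg_cancel (h : IsExpandingFlow N D a b) (t : ℝ) (x : Fin n → ℝ) :
    D t *ᵥ (D (-t) *ᵥ x) = x := by
  rw [← h.mulVec_add, add_neg_cancel, h.zero, Matrix.one_mulVec]

lemma mulVec_ne_zero (h : IsExpandingFlow N D a b) (s : ℝ) {x : Fin n → ℝ} (hx : x ≠ 0) :
    D s *ᵥ x ≠ 0 := by
  intro h0
  apply hx
  have := h.mulVec_neg_cancel (-s) x
  rw [neg_neg, h0, Matrix.mulVec_zero] at this
  exact this.symm

lemma continuous_mulVec (h : IsExpandingFlow N D a b) :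
    Continuous fun p : ℝ × (Fin n → ℝ) => D p.1 *ᵥ p.2 :=
  (h.continuous_flow.comp continuous_fst).matrix_mulVec continuous_snd

lemma monotone_sq (h : IsExpandingFlow N D a b) (x : Fin n → ℝ) :
    Monotone fun s => N (D s *ᵥ x) ^ 2 := by
  choose r hr using h.growth x
  exact monotone_of_hasDerivAt_nonneg (fun s => (hr s).1)
    fun s => (mul_nonneg h.a_pos.le (sq_nonneg _)).trans (hr s).2.1

lemma sq_add_le (h : IsExpandingFlow N D a b) (x : Fin n → ℝ) {s s' : ℝ} (hs : s ≤ s') :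
    N (D s *ᵥ x) ^ 2 + a * N (D s *ᵥ x) ^ 2 * (s' - s) ≤ N (D s' *ᵥ x) ^ 2 := by
  choose r hr using h.growth x
  have hmvt := (convex_Icc s s').mul_sub_le_image_sub_of_le_deriv
    (f := fun s => N (D s *ᵥ x) ^ 2)
    (fun y _ => (hr y).1.continuousAt.continuousWithinAt)
    (fun y _ => (hr y).1.differentiableAt.differentiableWithinAt)
    (C := a * N (D s *ᵥ x) ^ 2)
    (fun y hy => by
      rw [(hr y).1.deriv]
      have hmono : N (D s *ᵥ x) ^ 2 ≤ N (D y *ᵥ x) ^ 2 :=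
        h.monotone_sq x (interior_subset hy).1
      exact (mul_le_mul_of_nonneg_left hmono h.a_pos.le).trans (hr y).2.1)
    s (left_mem_Icc.2 hs) s' (right_mem_Icc.2 hs) hs
  linarith

lemma norm_le_norm_mulVec (h : IsExpandingFlow N D a b) (x : Fin n → ℝ) {s : ℝ} (hs : 0 ≤ s) :
    N x ≤ N (D s *ᵥ x) := by
  have := h.monotone_sq x hs
  simp only [h.zero, Matrix.one_mulVec] at this
  exact le_of_sq_le_sq this (apply_nonneg _ _)

lemma norm_mulVec_le (h : IsExpandingFlow N D a b) (x : Fin n → ℝ) {s : ℝ} (hs : 0 ≤ s)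
    (hs1 : s ≤ 1) : N (D s *ᵥ x) ≤ Real.exp b * N x := by
  choose r hr using h.growth x
  have hanti := antitone_of_hasDerivAt_nonpos
    (f := fun s => Real.exp (-b * s) * N (D s *ᵥ x) ^ 2)
    (f' := fun s => Real.exp (-b * s) * (-b * 1) * N (D s *ᵥ x) ^ 2 + Real.exp (-b * s) * r s)
    (fun s => (((hasDerivAt_id s).const_mul (-b)).exp).mul (hr s).1)
    (fun s => by
      have h1 := (hr s).2.2
      have h2 := Real.exp_pos (-b * s)
      have : Real.exp (-b * s) * (-b * 1) * N (D s *ᵥ x) ^ 2 + Real.exp (-b * s) * r s =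
        Real.exp (-b * s) * (r s - b * N (D s *ᵥ x) ^ 2) := by ring
      simp only [Pi.zero_apply, this]
      exact mul_nonpos_of_nonneg_of_nonpos h2.le (by linarith))
  have h1 := hanti hs
  simp only [h.zero, Matrix.one_mulVec, mul_zero, Real.exp_zero, one_mul] at h1
  have h2 : N (D s *ᵥ x) ^ 2 ≤ (Real.exp b * N x) ^ 2 := by
    calc N (D s *ᵥ x) ^ 2 = Real.exp (b * s) * (Real.exp (-b * s) * N (D s *ᵥ x) ^ 2) := by
          rw [← mul_assoc, ← Real.exp_add]; simp
      _ ≤ Real.exp (2 * b) * N x ^ 2 :=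
          mul_le_mul (Real.exp_le_exp.2 (by nlinarith [h.b_pos])) h1
            (mul_nonneg (Real.exp_pos _).le (sq_nonneg _)) (Real.exp_pos _).le
      _ = _ := by rw [mul_pow, two_mul, Real.exp_add]; ring
  exact le_of_sq_le_sq h2 (by have := apply_nonneg N x; positivity)

/-- Change of variables along a backward orbit: since `N` decreases there at a relative rate at
least `a / 2`, integrating a function of `N` against `N dt` amounts to integrating it over a part
of the line. -/
lemma lintegral_orbit_le (h : IsExpandingFlow N D a b) (u : Fin n → ℝ) (g : ℝ → ℝ≥0∞) :
    ∫⁻ t, ENNReal.ofReal (N (D (-t) *ᵥ u)) * g (N (D (-t) *ᵥ u)) ≤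
      ENNReal.ofReal (2 / a) * ∫⁻ m, g m := by
  rcases eq_or_ne u 0 with rfl | hu
  · simp
  have ha := h.a_pos
  choose r hr using h.growth u
  set m : ℝ → ℝ := fun t => N (D (-t) *ᵥ u) with hm
  have hmpos : ∀ t, 0 < m t := fun t => h.norm_pos (h.mulVec_ne_zero _ hu)
  set m' : ℝ → ℝ := fun t => -r (-t) / (2 * m t) with hm'
  have hd : ∀ t, HasDerivAt m (m' t) t := fun t => by
    have h1 : HasDerivAt (fun t => N (D (-t) *ᵥ u) ^ 2) (-r (-t)) t := by
      have h0 := (hr (-t)).1.scomp t (hasDerivAt_neg t)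
      rw [neg_one_smul] at h0
      exact h0
    have h2 := h1.sqrt (pow_ne_zero 2 (hmpos t).ne')
    have h3 : (fun t => √(N (D (-t) *ᵥ u) ^ 2)) = m := by
      ext s; exact Real.sqrt_sq (hmpos s).le
    rw [h3, Real.sqrt_sq (hmpos t).le] at h2
    exact h2
  have hneg : ∀ t, m' t ≤ -(a / 2 * m t) := fun t => by
    have h1 : a * m t ^ 2 ≤ r (-t) := (hr (-t)).2.1
    rw [hm', div_le_iff₀ (by have := hmpos t; positivity)]
    nlinarith [hmpos t]
  have hneg' : ∀ t, m' t < 0 := fun t =>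
    (hneg t).trans_lt (neg_lt_zero.2 (by have := hmpos t; positivity))
  have hanti : StrictAnti m := strictAnti_of_hasDerivAt_neg hd hneg'
  have hcv := lintegral_image_eq_lintegral_abs_deriv_mul MeasurableSet.univ
    (fun t _ => (hd t).hasDerivWithinAt) hanti.injective.injOn g
  rw [Measure.restrict_univ] at hcv
  calc ∫⁻ t, ENNReal.ofReal (m t) * g (m t)
      ≤ ∫⁻ t, ENNReal.ofReal (2 / a) * (ENNReal.ofReal |m' t| * g (m t)) := by
        refine lintegral_mono fun t => ?_
        rw [← mul_assoc, ← ENNReal.ofReal_mul (by positivity)]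
        gcongr
        rw [abs_of_neg (hneg' t)]
        have := hneg t
        calc m t = 2 / a * (a / 2 * m t) := by field_simp
          _ ≤ _ := by gcongr; linarith
    _ = ENNReal.ofReal (2 / a) * ∫⁻ t, ENNReal.ofReal |m' t| * g (m t) :=
        lintegral_const_mul' _ _ ENNReal.ofReal_ne_top
    _ ≤ _ := by
        rw [← hcv]
        gcongr
        exact Measure.restrict_le_self

/-- Gaussians in `N` are integrable over `ℝⁿ`. -/
lemma lintegral_gaussian_lt_top (h : IsExpandingFlow N D a b) {c : ℝ} (hc : 0 < c) :
    ∫⁻ y, ENNReal.ofReal (Real.exp (-c * N y ^ 2)) < ∞ := by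
  obtain ⟨k, hk, hN⟩ := h.lower
  set d := c * k ^ 2 / (n + 1) with hd
  have hd0 : 0 < d := by positivity
  have hint : Integrable (fun y : Fin n → ℝ => ∏ i, Real.exp (-d * y i ^ 2)) :=
    Integrable.fintype_prod (μ := fun _ => volume) fun _ => integrable_exp_neg_mul_sq hd0
  refine lt_of_le_of_lt (lintegral_mono fun y => ENNReal.ofReal_le_ofReal ?_)
    hint.lintegral_lt_top
  rw [← Real.exp_sum]
  apply Real.exp_le_exp.2
  have h1 : ∑ i, y i ^ 2 ≤ (n + 1) * ‖y‖ ^ 2 := by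
    have : ∀ i ∈ (Finset.univ : Finset (Fin n)), y i ^ 2 ≤ ‖y‖ ^ 2 := fun i _ =>
      sq_le_sq.2 (by simpa using norm_le_pi_norm y i)
    have := Finset.sum_le_card_nsmul _ _ _ this
    simp only [Finset.card_univ, Fintype.card_fin, nsmul_eq_mul] at this
    nlinarith [sq_nonneg ‖y‖]
  have h2 : k ^ 2 * ‖y‖ ^ 2 ≤ N y ^ 2 := by
    rw [← mul_pow]; exact pow_le_pow_left₀ (by positivity) (hN y) 2
  rw [← Finset.mul_sum]
  have h3 : d * ∑ i, y i ^ 2 ≤ c * (k ^ 2 * ‖y‖ ^ 2) := by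
    calc d * ∑ i, y i ^ 2 ≤ d * ((n + 1) * ‖y‖ ^ 2) := by gcongr
      _ = _ := by rw [hd]; field_simp
  nlinarith

lemma lintegral_real_gaussian_lt_top {c : ℝ} (hc : 0 < c) :
    ∫⁻ m : ℝ, ENNReal.ofReal (Real.exp (-c * m ^ 2)) < ∞ :=
  (integrable_exp_neg_mul_sq hc).lintegral_lt_top

/-- The integral of a Gaussian along the backward orbit of `u`, with respect to `N dt`, which is
comparable with arc length. -/
noncomputable def orbitKernel (N : Seminorm ℝ (Fin n → ℝ)) (D : ℝ → Matrix (Fin n) (Fin n) ℝ)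
    (c : ℝ) (x u : Fin n → ℝ) : ℝ≥0∞ :=
  ∫⁻ t, ENNReal.ofReal (N (D (-t) *ᵥ u)) *
    ENNReal.ofReal (Real.exp (-c * N (x - D (-t) *ᵥ u) ^ 2))

lemma continuous_backward (h : IsExpandingFlow N D a b) :
    Continuous fun p : (Fin n → ℝ) × ℝ => D (-p.2) *ᵥ p.1 :=
  h.continuous_mulVec.comp ((continuous_neg.comp continuous_snd).prodMk continuous_fst)

lemma measurable_orbit_integrand (h : IsExpandingFlow N D a b) (c : ℝ) :
    Measurable fun p : ((Fin n → ℝ) × (Fin n → ℝ)) × ℝ =>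
      ENNReal.ofReal (N (D (-p.2) *ᵥ p.1.2)) *
        ENNReal.ofReal (Real.exp (-c * N (p.1.1 - D (-p.2) *ᵥ p.1.2) ^ 2)) := by
  have h1 : Continuous fun p : ((Fin n → ℝ) × (Fin n → ℝ)) × ℝ => D (-p.2) *ᵥ p.1.2 :=
    h.continuous_backward.comp ((continuous_snd.comp continuous_fst).prodMk continuous_snd)
  have hN := h.continuous_norm
  have h2 : Continuous fun p : ((Fin n → ℝ) × (Fin n → ℝ)) × ℝ =>
      Real.exp (-c * N (p.1.1 - D (-p.2) *ᵥ p.1.2) ^ 2) := by fun_prop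
  have h3 : Continuous fun p : ((Fin n → ℝ) × (Fin n → ℝ)) × ℝ => N (D (-p.2) *ᵥ p.1.2) := by
    fun_prop
  exact h3.measurable.ennreal_ofReal.mul h2.measurable.ennreal_ofReal

lemma measurable_orbit_integrand_left (h : IsExpandingFlow N D a b) (c : ℝ) (u : Fin n → ℝ) :
    Measurable (Function.uncurry fun (y : Fin n → ℝ) (t : ℝ) =>
      ENNReal.ofReal (N (D (-t) *ᵥ u)) *
        ENNReal.ofReal (Real.exp (-c * N (y - D (-t) *ᵥ u) ^ 2))) := by
  have hN := h.continuous_norm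
  have hv : Continuous fun p : (Fin n → ℝ) × ℝ => D (-p.2) *ᵥ u :=
    h.continuous_backward.comp (continuous_const.prodMk continuous_snd)
  have h1 : Continuous fun p : (Fin n → ℝ) × ℝ => N (D (-p.2) *ᵥ u) := by fun_prop
  have h2 : Continuous fun p : (Fin n → ℝ) × ℝ =>
      Real.exp (-c * N (p.1 - D (-p.2) *ᵥ u) ^ 2) := by fun_prop
  exact h1.measurable.ennreal_ofReal.mul h2.measurable.ennreal_ofReal

lemma measurable_orbitKernel (h : IsExpandingFlow N D a b) (c : ℝ) :
    Measurable fun p : (Fin n → ℝ) × (Fin n → ℝ) => orbitKernel N D c p.1 p.2 :=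
  (h.measurable_orbit_integrand c).lintegral_prod_right'

lemma orbitKernel_le (h : IsExpandingFlow N D a b) {c : ℝ} (hc : 0 < c) (x u : Fin n → ℝ) :
    orbitKernel N D c x u ≤
      ENNReal.ofReal (2 / a) * ∫⁻ m : ℝ, ENNReal.ofReal (Real.exp (-c * m ^ 2)) := by
  have h1 := h.lintegral_orbit_le u fun m => ENNReal.ofReal (Real.exp (-c * (m - N x) ^ 2))
  rw [lintegral_sub_right_eq_self (fun m : ℝ => ENNReal.ofReal (Real.exp (-c * m ^ 2))) (N x)]
    at h1
  refine le_trans (lintegral_mono fun t => ?_) h1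
  refine mul_le_mul_right (ENNReal.ofReal_le_ofReal (Real.exp_le_exp.2 ?_)) _
  have h2 := sq_le_sq' (abs_le.1 (abs_sub_map_le_sub N x (D (-t) *ᵥ u))).1
    (abs_le.1 (abs_sub_map_le_sub N x (D (-t) *ᵥ u))).2
  nlinarith

lemma orbitKernel_mulVec_le (h : IsExpandingFlow N D a b) {c : ℝ} (hc : 0 < c) {s : ℝ}
    (hs : 0 ≤ s) (hs1 : s ≤ 1) (y u : Fin n → ℝ) :
    orbitKernel N D c (D s *ᵥ y) u ≤ ENNReal.ofReal (Real.exp b) * orbitKernel N D c y u := by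
  have hshift := lintegral_add_right_eq_self (μ := volume) (fun t : ℝ =>
    ENNReal.ofReal (N (D (-t) *ᵥ u)) *
    ENNReal.ofReal (Real.exp (-c * N (y - D (-t) *ᵥ u) ^ 2))) s
  rw [orbitKernel, orbitKernel, ← hshift, ← lintegral_const_mul' _ _ ENNReal.ofReal_ne_top]
  refine lintegral_mono fun t => ?_
  have hv : D (-t) *ᵥ u = D s *ᵥ (D (-(t + s)) *ᵥ u) := by
    rw [← h.mulVec_add]; congr 2; ring
  rw [hv, ← Matrix.mulVec_sub, ← mul_assoc, ← ENNReal.ofReal_mul (Real.exp_pos _).le]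
  gcongr ENNReal.ofReal ?_ * ENNReal.ofReal (Real.exp ?_)
  · exact h.norm_mulVec_le _ hs hs1
  · have h1 := h.norm_le_norm_mulVec (y - D (-(t + s)) *ᵥ u) hs
    have h2 := pow_le_pow_left₀ (apply_nonneg N _) h1 2
    nlinarith

/-- A Gaussian centred at `v` has bounded mass, and this mass within the ball `N ≤ ρ` is itself
Gaussian in `N v` when `v` is far from the ball. -/
lemma setLIntegral_gaussian_le {N : Seminorm ℝ (Fin n → ℝ)} {c : ℝ} (hc : 0 < c) {ρ : ℝ}
    {S : Set (Fin n → ℝ)} (hSm : MeasurableSet S) (hS : ∀ y ∈ S, N y ≤ ρ) (v : Fin n → ℝ) :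
    ∫⁻ y in S, ENNReal.ofReal (Real.exp (-c * N (y - v) ^ 2)) ≤
      (∫⁻ y, ENNReal.ofReal (Real.exp (-(c / 2) * N y ^ 2))) *
        ((Icc (0 : ℝ) (2 * ρ)).indicator 1 (N v) +
          ENNReal.ofReal (Real.exp (-(c / 8) * N v ^ 2))) := by
  set G := ∫⁻ y, ENNReal.ofReal (Real.exp (-(c / 2) * N y ^ 2)) with hG
  have htrans : ∫⁻ y, ENNReal.ofReal (Real.exp (-(c / 2) * N (y - v) ^ 2)) = G :=
    lintegral_sub_right_eq_self
      (fun y => ENNReal.ofReal (Real.exp (-(c / 2) * N y ^ 2))) v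
  rcases le_or_gt (N v) (2 * ρ) with hv | hv
  · calc ∫⁻ y in S, ENNReal.ofReal (Real.exp (-c * N (y - v) ^ 2))
        ≤ ∫⁻ y, ENNReal.ofReal (Real.exp (-c * N (y - v) ^ 2)) := setLIntegral_le_lintegral _ _
      _ ≤ ∫⁻ y, ENNReal.ofReal (Real.exp (-(c / 2) * N (y - v) ^ 2)) := by
        refine lintegral_mono fun y => ENNReal.ofReal_le_ofReal (Real.exp_le_exp.2 ?_)
        nlinarith [sq_nonneg (N (y - v))]
      _ = G * 1 := by rw [htrans, mul_one]
      _ ≤ G * ((Icc (0 : ℝ) (2 * ρ)).indicator 1 (N v) +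
          ENNReal.ofReal (Real.exp (-(c / 8) * N v ^ 2))) := by
        gcongr
        rw [indicator_of_mem (show N v ∈ Icc 0 (2 * ρ) from ⟨apply_nonneg _ _, hv⟩)]
        exact le_self_add
  · have hpt : ∀ y ∈ S, ENNReal.ofReal (Real.exp (-c * N (y - v) ^ 2)) ≤
        ENNReal.ofReal (Real.exp (-(c / 8) * N v ^ 2)) *
          ENNReal.ofReal (Real.exp (-(c / 2) * N (y - v) ^ 2)) := fun y hy => by
      rw [← ENNReal.ofReal_mul (Real.exp_pos _).le, ← Real.exp_add]
      refine ENNReal.ofReal_le_ofReal (Real.exp_le_exp.2 ?_)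
      have h1 : N y ≤ ρ := hS y hy
      have h2 : N v - N y ≤ N (y - v) := by
        have := (abs_le.1 (abs_sub_map_le_sub N y v)).1
        linarith
      have h3 : N v / 2 ≤ N (y - v) := by linarith
      have h4 : (N v / 2) ^ 2 ≤ N (y - v) ^ 2 :=
        pow_le_pow_left₀ (by have := apply_nonneg N v; positivity) h3 2
      nlinarith
    calc ∫⁻ y in S, ENNReal.ofReal (Real.exp (-c * N (y - v) ^ 2))
        ≤ ∫⁻ y in S, ENNReal.ofReal (Real.exp (-(c / 8) * N v ^ 2)) *
          ENNReal.ofReal (Real.exp (-(c / 2) * N (y - v) ^ 2)) := by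
          exact setLIntegral_mono' hSm hpt
      _ ≤ ∫⁻ y, ENNReal.ofReal (Real.exp (-(c / 8) * N v ^ 2)) *
          ENNReal.ofReal (Real.exp (-(c / 2) * N (y - v) ^ 2)) := setLIntegral_le_lintegral _ _
      _ = ENNReal.ofReal (Real.exp (-(c / 8) * N v ^ 2)) * G := by
          rw [lintegral_const_mul' _ _ ENNReal.ofReal_ne_top, htrans]
      _ ≤ G * ((Icc (0 : ℝ) (2 * ρ)).indicator 1 (N v) +
          ENNReal.ofReal (Real.exp (-(c / 8) * N v ^ 2))) := by
          rw [mul_comm]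
          gcongr
          exact le_add_self


/-- The orbit kernel has mass at most a constant times `√β` on the ellipsoid `N ^ 2 ≤ 2 β`: it is
concentrated in a tube of bounded width around a curve of length comparable with `√β`. -/
lemma exists_lintegral_orbitKernel_le (h : IsExpandingFlow N D a b) {c : ℝ} (hc : 0 < c) :
    ∃ C : ℝ, 0 < C ∧ ∀ β : ℝ, 1 ≤ β → ∀ u : Fin n → ℝ,
      ∫⁻ y in {y | N y ^ 2 ≤ 2 * β}, orbitKernel N D c y u ≤ ENNReal.ofReal (C * √β) := by
  have ha := h.a_pos
  set G := ∫⁻ y, ENNReal.ofReal (Real.exp (-(c / 2) * N y ^ 2)) with hG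
  set G₁ := ∫⁻ m : ℝ, ENNReal.ofReal (Real.exp (-(c / 8) * m ^ 2)) with hG₁
  have hGtop : G ≠ ∞ := (h.lintegral_gaussian_lt_top (by positivity)).ne
  have hG₁top : G₁ ≠ ∞ := (lintegral_real_gaussian_lt_top (by positivity)).ne
  refine ⟨(G.toReal + 1) * (2 / a) * (4 + G₁.toReal), by positivity, fun β hβ u => ?_⟩
  set S := {y : Fin n → ℝ | N y ^ 2 ≤ 2 * β} with hS
  set ρ := √(2 * β) with hρ
  set g : ℝ → ℝ≥0∞ := fun m => (Icc (0 : ℝ) (2 * ρ)).indicator 1 m +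
    ENNReal.ofReal (Real.exp (-(c / 8) * m ^ 2)) with hg
  have hinner : ∀ v : Fin n → ℝ,
      ∫⁻ y in S, ENNReal.ofReal (Real.exp (-c * N (y - v) ^ 2)) ≤ G * g (N v) := fun v =>
    setLIntegral_gaussian_le hc
      (measurableSet_le (h.continuous_norm.measurable.pow_const 2) measurable_const)
      (fun y hy => Real.le_sqrt_of_sq_le hy) v
  have hmeas := h.measurable_orbit_integrand_left c u
  have hgint : ∫⁻ m, g m = ENNReal.ofReal (2 * ρ) + G₁ := by
    rw [lintegral_add_left (measurable_one.indicator measurableSet_Icc),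
      lintegral_indicator_one measurableSet_Icc, Real.volume_Icc, sub_zero]
  have hβ1 : 1 ≤ √β := Real.one_le_sqrt.2 hβ
  calc ∫⁻ y in S, orbitKernel N D c y u
      = ∫⁻ t, ∫⁻ y in S, ENNReal.ofReal (N (D (-t) *ᵥ u)) *
          ENNReal.ofReal (Real.exp (-c * N (y - D (-t) *ᵥ u) ^ 2)) :=
        lintegral_lintegral_swap hmeas.aemeasurable
    _ ≤ ∫⁻ t, G * (ENNReal.ofReal (N (D (-t) *ᵥ u)) * g (N (D (-t) *ᵥ u))) := by
        refine lintegral_mono fun t => ?_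
        rw [lintegral_const_mul' _ _ ENNReal.ofReal_ne_top, mul_left_comm]
        gcongr
        exact hinner _
    _ = G * ∫⁻ t, ENNReal.ofReal (N (D (-t) *ᵥ u)) * g (N (D (-t) *ᵥ u)) :=
        lintegral_const_mul' _ _ hGtop
    _ ≤ G * (ENNReal.ofReal (2 / a) * ∫⁻ m, g m) := by gcongr; exact h.lintegral_orbit_le u g
    _ = ENNReal.ofReal (G.toReal * (2 / a * (2 * ρ + G₁.toReal))) := by
        rw [hgint, ENNReal.ofReal_mul ENNReal.toReal_nonneg, ENNReal.ofReal_toReal hGtop,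
          ENNReal.ofReal_mul (p := 2 / a) (by positivity), ENNReal.ofReal_add (by positivity)
          ENNReal.toReal_nonneg, ENNReal.ofReal_toReal hG₁top]
    _ ≤ _ := by
        refine ENNReal.ofReal_le_ofReal ?_
        have hρ2 : ρ ≤ 2 * √β := by
          rw [hρ, Real.sqrt_mul (by norm_num)]
          gcongr
          rw [Real.sqrt_le_left (by norm_num)]; norm_num
        calc G.toReal * (2 / a * (2 * ρ + G₁.toReal))
            ≤ (G.toReal + 1) * (2 / a * (2 * (2 * √β) + G₁.toReal * √β)) := by
              gcongr
              · linarith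
              · exact le_mul_of_one_le_right ENNReal.toReal_nonneg hβ1
          _ = _ := by ring

end IsExpandingFlow

/-! ### The majorant of the variation and superlevel sets -/

namespace IsExpandingFlow

variable {N : Seminorm ℝ (Fin n → ℝ)} {D : ℝ → Matrix (Fin n) (Fin n) ℝ} {a b : ℝ}

/-- The time integral over `[1, ∞)` of the bound for the derivative of the Mehler kernel. -/
noncomputable def variationMajorant (N : Seminorm ℝ (Fin n → ℝ))
    (D : ℝ → Matrix (Fin n) (Fin n) ℝ) (c d : ℝ) (x u : Fin n → ℝ) : ℝ≥0∞ :=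
  ∫⁻ t in Ioi 1, ENNReal.ofReal (Real.exp (-c * N (x - D (-t) *ᵥ u) ^ 2) *
    (Real.exp (-d * t) + N (D (-t) *ᵥ u)))

lemma setLIntegral_exp_eq {d : ℝ} (hd : 0 < d) (r : ℝ) :
    ∫⁻ t in Ioi r, ENNReal.ofReal (Real.exp (-d * t)) =
      ENNReal.ofReal (Real.exp (-d * r) / d) := by
  rw [← ofReal_integral_eq_lintegral_ofReal (integrableOn_exp_mul_Ioi (by linarith) r)
    (Eventually.of_forall fun t => (Real.exp_pos _).le), integral_exp_mul_Ioi (by linarith),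
    neg_div_neg_eq]

lemma setLIntegral_exp_le {d : ℝ} (hd : 0 < d) :
    ∫⁻ t in Ioi (1 : ℝ), ENNReal.ofReal (Real.exp (-d * t)) ≤ ENNReal.ofReal (1 / d) := by
  rw [setLIntegral_exp_eq hd]
  gcongr
  exact Real.exp_le_one_iff.2 (by linarith)

lemma variationMajorant_le (N : Seminorm ℝ (Fin n → ℝ))
    (D : ℝ → Matrix (Fin n) (Fin n) ℝ) {c d k : ℝ}
    (hd : 0 < d) (hk : 0 ≤ k) {x u : Fin n → ℝ} {δ : ℝ}
    (hδ : ∀ t, 0 ≤ t → Real.exp (-c * N (x - D (-t) *ᵥ u) ^ 2) * Real.exp (-d * t) ≤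
      k * (N (D (-t) *ᵥ u) * Real.exp (-c * N (x - D (-t) *ᵥ u) ^ 2)) +
        δ * Real.exp (-d * t)) (hδ0 : 0 ≤ δ) :
    variationMajorant N D c d x u ≤
      ENNReal.ofReal (k + 1) * orbitKernel N D c x u + ENNReal.ofReal (δ * (1 / d)) := by
  calc variationMajorant N D c d x u
      ≤ ∫⁻ t in Ioi 1, (ENNReal.ofReal δ * ENNReal.ofReal (Real.exp (-d * t)) +
          ENNReal.ofReal (k + 1) * (ENNReal.ofReal (N (D (-t) *ᵥ u)) *
          ENNReal.ofReal (Real.exp (-c * N (x - D (-t) *ᵥ u) ^ 2)))) := by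
        refine setLIntegral_mono' measurableSet_Ioi fun t ht => ?_
        have hN := apply_nonneg N (D (-t) *ᵥ u)
        rw [← ENNReal.ofReal_mul hN, ← ENNReal.ofReal_mul hδ0,
          ← ENNReal.ofReal_mul (p := k + 1) (by positivity), ← ENNReal.ofReal_add (by positivity) (by positivity)]
        refine ENNReal.ofReal_le_ofReal ?_
        have := hδ t (by linarith [mem_Ioi.1 ht])
        linarith
    _ = ENNReal.ofReal δ * (∫⁻ t in Ioi (1 : ℝ), ENNReal.ofReal (Real.exp (-d * t))) +
          ENNReal.ofReal (k + 1) * ∫⁻ t in Ioi 1, (ENNReal.ofReal (N (D (-t) *ᵥ u)) *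
          ENNReal.ofReal (Real.exp (-c * N (x - D (-t) *ᵥ u) ^ 2))) := by
        rw [lintegral_add_left (by fun_prop), lintegral_const_mul' _ _ ENNReal.ofReal_ne_top,
          lintegral_const_mul' _ _ ENNReal.ofReal_ne_top]
    _ ≤ ENNReal.ofReal δ * ENNReal.ofReal (1 / d) +
          ENNReal.ofReal (k + 1) * orbitKernel N D c x u := by
        gcongr
        · exact setLIntegral_exp_le hd
        · exact setLIntegral_le_lintegral _ _
    _ = _ := by rw [add_comm, ← ENNReal.ofReal_mul hδ0]

lemma exists_variationMajorant_le (h : IsExpandingFlow N D a b) {c d : ℝ} (hc : 0 < c)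
    (hd : 0 < d) : ∃ K : ℝ, 0 < K ∧ ∀ x u, variationMajorant N D c d x u ≤ ENNReal.ofReal K := by
  have ha := h.a_pos
  set G := ∫⁻ m : ℝ, ENNReal.ofReal (Real.exp (-c * m ^ 2)) with hG
  have hGtop : G ≠ ∞ := (lintegral_real_gaussian_lt_top hc).ne
  refine ⟨2 / a * G.toReal + 1 / d, by positivity, fun x u => ?_⟩
  refine (variationMajorant_le N D hd le_rfl (δ := 1) (fun t _ => ?_) zero_le_one).trans ?_
  · rw [zero_mul, zero_add]
    gcongr
    exact Real.exp_le_one_iff.2 (by nlinarith [sq_nonneg (N (x - D (-t) *ᵥ u))])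
  · rw [zero_add, ENNReal.ofReal_one, one_mul, one_mul,
      ENNReal.ofReal_add (by positivity) (by positivity), ENNReal.ofReal_mul (by positivity),
      ENNReal.ofReal_toReal hGtop]
    gcongr
    exact h.orbitKernel_le hc x u

/-- Away from the unit ball the term `e^{-dt}` is harmless: either the orbit is at distance at
least `1 / 2` from the origin, or it is far from `x` and the Gaussian factor is small. -/
lemma variationMajorant_le_of_one_le (N : Seminorm ℝ (Fin n → ℝ))
    (D : ℝ → Matrix (Fin n) (Fin n) ℝ) {c d : ℝ} (hc : 0 < c) (hd : 0 < d) {x : Fin n → ℝ}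
    (hx : 1 ≤ N x) (u : Fin n → ℝ) :
    variationMajorant N D c d x u ≤ ENNReal.ofReal 3 * orbitKernel N D c x u +
      ENNReal.ofReal (Real.exp (-(c / 4) * N x ^ 2) * (1 / d)) := by
  have h := variationMajorant_le N D (c := c) (x := x) (u := u) hd (zero_le_two (α := ℝ))
    (δ := Real.exp (-(c / 4) * N x ^ 2)) (fun t ht => ?_) (Real.exp_pos _).le
  · norm_num at h ⊢
    exact h
  set v := D (-t) *ᵥ u
  have hv : 0 ≤ N v := apply_nonneg N v
  have hexp : Real.exp (-d * t) ≤ 1 := Real.exp_le_one_iff.2 (by nlinarith)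
  rcases le_or_gt (N x / 2) (N v) with hxv | hxv
  · have h1 : Real.exp (-d * t) ≤ 2 * N v := by linarith
    calc Real.exp (-c * N (x - v) ^ 2) * Real.exp (-d * t)
        ≤ Real.exp (-c * N (x - v) ^ 2) * (2 * N v) := by gcongr
      _ = 2 * (N v * Real.exp (-c * N (x - v) ^ 2)) := by ring
      _ ≤ _ := le_add_of_nonneg_right (by positivity)
  · have h1 : N x / 2 ≤ N (x - v) := by
      have := (abs_le.1 (abs_sub_map_le_sub N x v)).2
      linarith
    have h2 : (N x / 2) ^ 2 ≤ N (x - v) ^ 2 := pow_le_pow_left₀ (by linarith) h1 2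
    calc Real.exp (-c * N (x - v) ^ 2) * Real.exp (-d * t)
        ≤ Real.exp (-(c / 4) * N x ^ 2) * Real.exp (-d * t) := by
          gcongr ?_ * _
          exact Real.exp_le_exp.2 (by nlinarith)
      _ ≤ _ := le_add_of_nonneg_left (by positivity)

/-- If `φ` grows linearly with slope `r` from every point of `J`, then the integral of `e^{-φ}` over
`J` is at most `1 / r` times an upper bound of `e^{-φ}` on `J`: only the first point of `J`
matters. -/
lemma lintegral_indicator_exp_neg_le {φ : ℝ → ℝ} {J : Set ℝ} {r : ℝ} {L : ℝ≥0∞} (hr : 0 < r)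
    (hJ : BddBelow J) (hφ : ∀ s ∈ J, ∀ s', s ≤ s' → φ s + r * (s' - s) ≤ φ s')
    (hL : ∀ s ∈ J, ENNReal.ofReal (Real.exp (-φ s)) ≤ L) :
    ∫⁻ s, J.indicator (fun s => ENNReal.ofReal (Real.exp (-φ s))) s ≤
      L * ENNReal.ofReal (1 / r) := by
  rcases eq_or_ne L ∞ with rfl | hLtop
  · rw [ENNReal.top_mul (by simpa using hr)]
    exact le_top
  rcases J.eq_empty_or_nonempty with rfl | hne
  · simp
  obtain ⟨w, -, hw, hwJ⟩ := exists_seq_tendsto_sInf hne hJ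
  set σ := sInf J with hσ
  have hpt : ∀ s ∈ J, ENNReal.ofReal (Real.exp (-φ s)) ≤
      L * ENNReal.ofReal (Real.exp (-r * (s - σ))) := fun s hs => by
    rw [← ENNReal.ofReal_toReal hLtop, ← ENNReal.ofReal_mul ENNReal.toReal_nonneg]
    refine ENNReal.ofReal_le_ofReal ?_
    rcases (csInf_le hJ hs).eq_or_lt with heq | hlt
    · rw [← heq, ← hσ, sub_self, mul_zero, Real.exp_zero, mul_one, hσ, heq]
      exact (ENNReal.ofReal_le_iff_le_toReal hLtop).1 (hL s hs)
    · have hlim : Tendsto (fun k => L.toReal * Real.exp (-r * (s - w k))) atTop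
          (𝓝 (L.toReal * Real.exp (-r * (s - σ)))) := by
        have hc : Continuous fun y : ℝ => L.toReal * Real.exp (-r * (s - y)) := by fun_prop
        exact (hc.tendsto σ).comp hw
      refine ge_of_tendsto hlim ?_
      filter_upwards [hw.eventually_lt_const hlt] with k hk
      have h1 := hφ (w k) (hwJ k) s hk.le
      have h2 := (ENNReal.ofReal_le_iff_le_toReal hLtop).1 (hL (w k) (hwJ k))
      calc Real.exp (-φ s) ≤ Real.exp (-φ (w k) + -r * (s - w k)) :=
            Real.exp_le_exp.2 (by linarith)
        _ = Real.exp (-φ (w k)) * Real.exp (-r * (s - w k)) := Real.exp_add _ _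
        _ ≤ _ := by gcongr
  calc ∫⁻ s, J.indicator (fun s => ENNReal.ofReal (Real.exp (-φ s))) s
      ≤ ∫⁻ s, (Ici σ).indicator (fun s => L * ENNReal.ofReal (Real.exp (-r * (s - σ)))) s := by
        refine lintegral_mono fun s => ?_
        by_cases hs : s ∈ J
        · rw [indicator_of_mem hs, indicator_of_mem (show s ∈ Ici σ from csInf_le hJ hs)]
          exact hpt s hs
        · rw [indicator_of_notMem hs]
          exact zero_le
    _ = ∫⁻ s in Ioi σ, L * ENNReal.ofReal (Real.exp (r * σ)) *
          ENNReal.ofReal (Real.exp (-r * s)) := by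
        rw [lintegral_indicator measurableSet_Ici, setLIntegral_congr Ioi_ae_eq_Ici.symm]
        refine lintegral_congr fun s => ?_
        rw [mul_assoc, ← ENNReal.ofReal_mul (Real.exp_pos _).le, ← Real.exp_add]
        congr 3; ring
    _ = L * ENNReal.ofReal (1 / r) := by
        rw [lintegral_const_mul' _ _ (ENNReal.mul_ne_top hLtop ENNReal.ofReal_ne_top),
          setLIntegral_exp_eq hr, mul_assoc, ← ENNReal.ofReal_mul (Real.exp_pos _).le,
          ← mul_div_assoc, ← Real.exp_add]
        congr 3
        rw [← Real.exp_zero]; congr 1; ring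

lemma det_ne_zero (h : IsExpandingFlow N D a b) (s : ℝ) : (D s).det ≠ 0 := by
  intro h0
  have h1 : D s * D (-s) = 1 := by rw [← h.add, add_neg_cancel, h.zero]
  have h2 := congrArg Matrix.det h1
  rw [Matrix.det_mul, h0, zero_mul, Matrix.det_one] at h2
  exact zero_ne_one h2

lemma lintegral_eq_det_mul (h : IsExpandingFlow N D a b) (s : ℝ) {w : (Fin n → ℝ) → ℝ≥0∞}
    (hw : Measurable w) :
    ∫⁻ x, w x = ENNReal.ofReal |(D s).det| * ∫⁻ y, w (D s *ᵥ y) := by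
  have hdet := h.det_ne_zero s
  have hmap := Real.map_matrix_volume_pi_eq_smul_volume_pi hdet
  have hm : Measurable (Matrix.toLin' (D s)) := by
    have : Continuous fun y : Fin n → ℝ => D s *ᵥ y :=
      continuous_const.matrix_mulVec continuous_id
    exact this.measurable
  have h1 : ∫⁻ y, w (D s *ᵥ y) = ENNReal.ofReal |(D s).det⁻¹| * ∫⁻ x, w x := by
    rw [← smul_eq_mul, ← lintegral_smul_measure, ← hmap, lintegral_map hw hm]
    rfl
  rw [h1, ← mul_assoc, ← ENNReal.ofReal_mul (abs_nonneg _), ← abs_mul, mul_inv_cancel₀ hdet,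
    abs_one, ENNReal.ofReal_one, one_mul]

lemma exists_abs_det_le (h : IsExpandingFlow N D a b) :
    ∃ K : ℝ, 0 < K ∧ ∀ s ∈ Icc (0 : ℝ) 1, |(D s).det| ≤ K := by
  have hc : Continuous fun s => |(D s).det| := (h.continuous_flow.matrix_det).abs
  obtain ⟨K, hK⟩ := (isCompact_Icc (a := (0 : ℝ)) (b := 1)).bddAbove_image hc.continuousOn
  exact ⟨|K| + 1, by positivity, fun s hs =>
    (hK (mem_image_of_mem _ hs)).trans ((le_abs_self K).trans (by linarith))⟩

/-- The Gaussian mass of the part of the annulus `β / 2 ≤ N ^ 2 ≤ 2 β` where `e^{N ^ 2} H` exceeds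
`l`, when `H` is almost constant along the flow. Averaging over unit time turns the volume
integral into integrals along orbits, and on each of these `e^{-N ^ 2}` decays at the rate `a β / 2`
from its first value `H / l`. -/
lemma exists_setLIntegral_superlevel_le (h : IsExpandingFlow N D a b) :
    ∃ C : ℝ, 0 < C ∧ ∀ β l : ℝ, 0 < β → 0 < l → ∀ H : (Fin n → ℝ) → ℝ≥0∞, Measurable H →
      (∀ s, 0 ≤ s → s ≤ 1 → ∀ y, H (D s *ᵥ y) ≤ ENNReal.ofReal (Real.exp b) * H y) →
      ∫⁻ x in {x | β / 2 ≤ N x ^ 2 ∧ N x ^ 2 ≤ 2 * β ∧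
          ENNReal.ofReal l ≤ ENNReal.ofReal (Real.exp (N x ^ 2)) * H x},
        ENNReal.ofReal (Real.exp (-N x ^ 2)) ≤
      ENNReal.ofReal (C / (l * β)) * ∫⁻ y in {y | N y ^ 2 ≤ 2 * β}, H y := by
  obtain ⟨K, hK, hdet⟩ := h.exists_abs_det_le
  have ha := h.a_pos
  refine ⟨K * (Real.exp b * (2 / a)), by positivity, fun β l hβ hl H hHm hH => ?_⟩
  set E := {x | β / 2 ≤ N x ^ 2 ∧ N x ^ 2 ≤ 2 * β ∧
          ENNReal.ofReal l ≤ ENNReal.ofReal (Real.exp (N x ^ 2)) * H x} with hE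
  have hNm : Measurable fun x => N x ^ 2 := h.continuous_norm.measurable.pow_const 2
  have hEm : MeasurableSet E :=
    (measurableSet_le measurable_const hNm).inter ((measurableSet_le hNm measurable_const).inter
      (measurableSet_le measurable_const (hNm.exp.ennreal_ofReal.mul hHm)))
  set w : (Fin n → ℝ) → ℝ≥0∞ := E.indicator fun x => ENNReal.ofReal (Real.exp (-N x ^ 2)) with hw
  have hwm : Measurable w := hNm.neg.exp.ennreal_ofReal.indicator hEm
  have hSm : MeasurableSet {y : Fin n → ℝ | N y ^ 2 ≤ 2 * β} :=
    measurableSet_le hNm measurable_const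
  have hinner : ∀ y, ∫⁻ s in Icc (0 : ℝ) 1, w (D s *ᵥ y) ≤
      {y | N y ^ 2 ≤ 2 * β}.indicator (fun y => ENNReal.ofReal (Real.exp b * (2 / a) / (l * β)) *
        H y) y := fun y => by
    rw [← lintegral_indicator measurableSet_Icc]
    set J := Icc (0 : ℝ) 1 ∩ {s | D s *ᵥ y ∈ E} with hJ
    have hJeq : (Icc (0 : ℝ) 1).indicator (fun s => w (D s *ᵥ y)) =
        J.indicator fun s => ENNReal.ofReal (Real.exp (-N (D s *ᵥ y) ^ 2)) := by
      rw [hJ, ← indicator_indicator]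
      rfl
    rw [hJeq]
    by_cases hy : N y ^ 2 ≤ 2 * β
    · rw [indicator_of_mem (show y ∈ {y | N y ^ 2 ≤ 2 * β} from hy)]
      refine (lintegral_indicator_exp_neg_le (φ := fun s => N (D s *ᵥ y) ^ 2) (J := J)
        (r := a * (β / 2)) (L := ENNReal.ofReal (Real.exp b / l) * H y) (by positivity)
        ⟨0, fun s hs => hs.1.1⟩ ?_ ?_).trans_eq ?_
      · intro s hs s' hss
        refine le_trans ?_ (h.sq_add_le y hss)
        have h1 : β / 2 ≤ N (D s *ᵥ y) ^ 2 := hs.2.1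
        gcongr
      · intro s hs
        have h1 : ENNReal.ofReal l ≤ ENNReal.ofReal (Real.exp (N (D s *ᵥ y) ^ 2)) *
          H (D s *ᵥ y) := hs.2.2.2
        have h2 := hH s hs.1.1 hs.1.2 y
        calc ENNReal.ofReal (Real.exp (-N (D s *ᵥ y) ^ 2))
            = ENNReal.ofReal (Real.exp (-N (D s *ᵥ y) ^ 2) / l) * ENNReal.ofReal l := by
              rw [← ENNReal.ofReal_mul (by positivity), div_mul_cancel₀ _ hl.ne']
          _ ≤ ENNReal.ofReal (Real.exp (-N (D s *ᵥ y) ^ 2) / l) *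
              (ENNReal.ofReal (Real.exp (N (D s *ᵥ y) ^ 2)) *
              (ENNReal.ofReal (Real.exp b) * H y)) := by
              gcongr
              exact h1.trans (by gcongr)
          _ = _ := by
              rw [← mul_assoc, ← mul_assoc, ← ENNReal.ofReal_mul (by positivity),
                ← ENNReal.ofReal_mul (by positivity)]
              congr 2
              rw [Real.exp_neg]
              field_simp
      · rw [mul_right_comm, ← ENNReal.ofReal_mul (by positivity)]
        congr 2
        field_simp
    · have hJempty : J = ∅ := by
        refine eq_empty_iff_forall_notMem.2 fun s hs => hy ?_
        have h1 : N (D s *ᵥ y) ^ 2 ≤ 2 * β := hs.2.2.1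
        exact (pow_le_pow_left₀ (apply_nonneg _ _) (h.norm_le_norm_mulVec y hs.1.1) 2).trans h1
      rw [hJempty]
      simp
  have hmeas : Measurable (Function.uncurry fun (s : ℝ) (y : Fin n → ℝ) => w (D s *ᵥ y)) :=
    hwm.comp h.continuous_mulVec.measurable
  calc ∫⁻ x in E, ENNReal.ofReal (Real.exp (-N x ^ 2))
      = ∫⁻ x, w x := by rw [hw, lintegral_indicator hEm]
    _ = ∫⁻ _ in Icc (0 : ℝ) 1, ∫⁻ x, w x := by simp
    _ ≤ ∫⁻ s in Icc (0 : ℝ) 1, ENNReal.ofReal K * ∫⁻ y, w (D s *ᵥ y) := by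
        refine setLIntegral_mono' measurableSet_Icc fun s hs => ?_
        rw [h.lintegral_eq_det_mul s hwm]
        gcongr
        exact hdet s hs
    _ = ENNReal.ofReal K * ∫⁻ y, ∫⁻ s in Icc (0 : ℝ) 1, w (D s *ᵥ y) := by
        rw [lintegral_const_mul' _ _ ENNReal.ofReal_ne_top,
          lintegral_lintegral_swap hmeas.aemeasurable]
    _ ≤ ENNReal.ofReal K * ∫⁻ y, {y | N y ^ 2 ≤ 2 * β}.indicator
          (fun y => ENNReal.ofReal (Real.exp b * (2 / a) / (l * β)) * H y) y := by
        gcongr with y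
        exact hinner y
    _ = _ := by
        rw [lintegral_indicator hSm, lintegral_const_mul' _ _ ENNReal.ofReal_ne_top, ← mul_assoc,
          ← ENNReal.ofReal_mul hK.le, ← mul_div_assoc]

end IsExpandingFlow

/-! ### The enhanced weak type estimate for the majorant -/

namespace IsExpandingFlow

variable {N : Seminorm ℝ (Fin n → ℝ)} {D : ℝ → Matrix (Fin n) (Fin n) ℝ} {a b : ℝ}

lemma measurableSet_sq_le (h : IsExpandingFlow N D a b) (r : ℝ) :
    MeasurableSet {y : Fin n → ℝ | N y ^ 2 ≤ r} :=
  measurableSet_le (h.continuous_norm.measurable.pow_const 2) measurable_const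

lemma measurable_lintegral_orbitKernel (h : IsExpandingFlow N D a b) (c : ℝ)
    (μ : Measure (Fin n → ℝ)) [SFinite μ] :
    Measurable fun y => ∫⁻ u, orbitKernel N D c y u ∂μ :=
  (h.measurable_orbitKernel c).lintegral_prod_right'

lemma lintegral_orbitKernel_mulVec_le (h : IsExpandingFlow N D a b) {c : ℝ} (hc : 0 < c)
    (μ : Measure (Fin n → ℝ)) {s : ℝ} (hs : 0 ≤ s) (hs1 : s ≤ 1) (y : Fin n → ℝ) :
    ∫⁻ u, orbitKernel N D c (D s *ᵥ y) u ∂μ ≤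
      ENNReal.ofReal (Real.exp b) * ∫⁻ u, orbitKernel N D c y u ∂μ := by
  rw [← lintegral_const_mul' _ _ ENNReal.ofReal_ne_top]
  exact lintegral_mono fun u => h.orbitKernel_mulVec_le hc hs hs1 y u

lemma setLIntegral_lintegral_orbitKernel_le (h : IsExpandingFlow N D a b) {c C β : ℝ}
    (hC : ∀ u : Fin n → ℝ,
      ∫⁻ y in {y | N y ^ 2 ≤ 2 * β}, orbitKernel N D c y u ≤ ENNReal.ofReal (C * √β))
    (μ : Measure (Fin n → ℝ)) [IsProbabilityMeasure μ] :
    ∫⁻ y in {y | N y ^ 2 ≤ 2 * β}, ∫⁻ u, orbitKernel N D c y u ∂μ ≤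
      ENNReal.ofReal (C * √β) := by
  rw [lintegral_lintegral_swap (h.measurable_orbitKernel c).aemeasurable]
  refine (lintegral_mono hC).trans ?_
  rw [lintegral_const, measure_univ, mul_one]

lemma volume_sq_le_le (h : IsExpandingFlow N D a b) {c : ℝ} (hc : 0 < c) (β : ℝ) :
    volume {y : Fin n → ℝ | N y ^ 2 ≤ 2 * β} ≤ ENNReal.ofReal (Real.exp (c / 8 * β)) *
      ∫⁻ y, ENNReal.ofReal (Real.exp (-(c / 16) * N y ^ 2)) := by
  rw [← setLIntegral_one, ← lintegral_const_mul' _ _ ENNReal.ofReal_ne_top]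
  refine (setLIntegral_mono' (h.measurableSet_sq_le _) fun y hy => ?_).trans
    (setLIntegral_le_lintegral _ _)
  rw [← ENNReal.ofReal_mul (Real.exp_pos _).le, ← Real.exp_add, ← ENNReal.ofReal_one]
  refine ENNReal.ofReal_le_ofReal (Real.one_le_exp ?_)
  have : N y ^ 2 ≤ 2 * β := hy
  nlinarith

/-- The superlevel estimate in an annulus, for the majorant averaged over a probability measure. -/
lemma exists_setLIntegral_annulus_le (h : IsExpandingFlow N D a b) {c d : ℝ} (hc : 0 < c)
    (hd : 0 < d) :
    ∃ C : ℝ, 0 < C ∧ ∀ β l : ℝ, 2 ≤ β → 0 < l → ∀ μ : Measure (Fin n → ℝ),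
      IsProbabilityMeasure μ →
      ∫⁻ x in {x | β / 2 ≤ N x ^ 2 ∧ N x ^ 2 ≤ 2 * β ∧
          ENNReal.ofReal l ≤ ENNReal.ofReal (Real.exp (N x ^ 2)) *
            ∫⁻ u, variationMajorant N D c d x u ∂μ},
        ENNReal.ofReal (Real.exp (-N x ^ 2)) ≤ ENNReal.ofReal (C / (l * √β)) := by
  obtain ⟨C₁, hC₁, h₁⟩ := h.exists_setLIntegral_superlevel_le
  obtain ⟨C₂, hC₂, h₂⟩ := h.exists_lintegral_orbitKernel_le hc
  set G := ∫⁻ y, ENNReal.ofReal (Real.exp (-(c / 16) * N y ^ 2)) with hG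
  have hGtop : G ≠ ∞ := (h.lintegral_gaussian_lt_top (by positivity)).ne
  refine ⟨C₁ * (3 * C₂ + 1 / d * G.toReal), by positivity, fun β l hβ hl μ hμ => ?_⟩
  have hβ0 : 0 < β := by linarith
  have hβ1 : 1 ≤ √β := Real.one_le_sqrt.2 (by linarith)
  set κ := Real.exp (-(c / 8 * β)) * (1 / d) with hκ
  have hκ0 : 0 < κ := by positivity
  set H : (Fin n → ℝ) → ℝ≥0∞ := fun y =>
    ENNReal.ofReal 3 * ∫⁻ u, orbitKernel N D c y u ∂μ + ENNReal.ofReal κ with hH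
  have hHm : Measurable H :=
    ((h.measurable_lintegral_orbitKernel c μ).const_mul _).add_const _
  have hHflow : ∀ s, 0 ≤ s → s ≤ 1 → ∀ y, H (D s *ᵥ y) ≤ ENNReal.ofReal (Real.exp b) * H y :=
    fun s hs hs1 y => by
      rw [hH]
      simp only
      rw [mul_add, mul_left_comm]
      gcongr
      · exact h.lintegral_orbitKernel_mulVec_le hc μ hs hs1 y
      · rw [← ENNReal.ofReal_mul (Real.exp_pos _).le]
        exact ENNReal.ofReal_le_ofReal
          (le_mul_of_one_le_left hκ0.le (Real.one_le_exp h.b_pos.le))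
  have hle : ∀ x, β / 2 ≤ N x ^ 2 → ∫⁻ u, variationMajorant N D c d x u ∂μ ≤ H x := fun x hx => by
    have hx1 : 1 ≤ N x := by
      refine le_of_sq_le_sq ?_ (apply_nonneg N x)
      rw [one_pow]; linarith
    calc ∫⁻ u, variationMajorant N D c d x u ∂μ
        ≤ ∫⁻ u, (ENNReal.ofReal 3 * orbitKernel N D c x u + ENNReal.ofReal κ) ∂μ := by
          refine lintegral_mono fun u => (variationMajorant_le_of_one_le N D hc hd hx1 u).trans ?_
          gcongr
          rw [hκ]
          gcongr
          nlinarith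
      _ = H x := by
          rw [lintegral_add_right _ measurable_const, lintegral_const, measure_univ, mul_one,
            lintegral_const_mul' _ _ ENNReal.ofReal_ne_top]
  refine (lintegral_mono_set fun x hx => ?_).trans ((h₁ β l hβ0 hl H hHm hHflow).trans ?_)
  · exact ⟨hx.1, hx.2.1, hx.2.2.trans (by gcongr; exact hle x hx.1)⟩
  have hκvol : ENNReal.ofReal κ * volume {y : Fin n → ℝ | N y ^ 2 ≤ 2 * β} ≤
      ENNReal.ofReal (1 / d * G.toReal) := by
    calc ENNReal.ofReal κ * volume {y : Fin n → ℝ | N y ^ 2 ≤ 2 * β}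
        ≤ ENNReal.ofReal κ * (ENNReal.ofReal (Real.exp (c / 8 * β)) * G) := by
          gcongr
          exact h.volume_sq_le_le hc β
      _ = ENNReal.ofReal (1 / d * G.toReal) := by
          rw [← mul_assoc, ENNReal.ofReal_mul (p := 1 / d) (by positivity),
            ENNReal.ofReal_toReal hGtop, ← ENNReal.ofReal_mul hκ0.le]
          congr 2
          rw [hκ, mul_right_comm, ← Real.exp_add, neg_add_cancel, Real.exp_zero, one_mul]
  have hint : ∫⁻ y in {y : Fin n → ℝ | N y ^ 2 ≤ 2 * β}, H y ≤
      ENNReal.ofReal ((3 * C₂ + 1 / d * G.toReal) * √β) := by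
    calc ∫⁻ y in {y : Fin n → ℝ | N y ^ 2 ≤ 2 * β}, H y
        = ENNReal.ofReal 3 * (∫⁻ y in {y | N y ^ 2 ≤ 2 * β}, ∫⁻ u, orbitKernel N D c y u ∂μ) +
          ENNReal.ofReal κ * volume {y : Fin n → ℝ | N y ^ 2 ≤ 2 * β} := by
          rw [lintegral_add_right _ measurable_const, setLIntegral_const,
            lintegral_const_mul' _ _ ENNReal.ofReal_ne_top]
      _ ≤ ENNReal.ofReal 3 * ENNReal.ofReal (C₂ * √β) + ENNReal.ofReal (1 / d * G.toReal) := by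
          gcongr
          exact h.setLIntegral_lintegral_orbitKernel_le (h₂ β (by linarith)) μ
      _ = ENNReal.ofReal (3 * (C₂ * √β) + 1 / d * G.toReal) := by
          rw [← ENNReal.ofReal_mul (by norm_num), ENNReal.ofReal_add (by positivity)
            (by positivity)]
      _ ≤ _ := by
          refine ENNReal.ofReal_le_ofReal ?_
          have : 1 / d * G.toReal ≤ 1 / d * G.toReal * √β :=
            le_mul_of_one_le_right (by positivity) hβ1
          linarith
  calc ENNReal.ofReal (C₁ / (l * β)) * ∫⁻ y in {y : Fin n → ℝ | N y ^ 2 ≤ 2 * β}, H y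
      ≤ ENNReal.ofReal (C₁ / (l * β)) * ENNReal.ofReal ((3 * C₂ + 1 / d * G.toReal) * √β) := by
        gcongr
    _ = _ := by
        rw [← ENNReal.ofReal_mul (by positivity)]
        congr 1
        have : β = √β * √β := (Real.mul_self_sqrt hβ0.le).symm
        rw [div_mul_eq_mul_div, div_eq_div_iff (by positivity) (by positivity)]
        linear_combination (-(C₁ * (3 * C₂ + 1 / d * G.toReal) * l)) * this

lemma setLIntegral_gaussian_tail_le (N : Seminorm ℝ (Fin n → ℝ)) {β : ℝ}
    (hm : MeasurableSet {x : Fin n → ℝ | 2 * β < N x ^ 2}) :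
    ∫⁻ x in {x | 2 * β < N x ^ 2}, ENNReal.ofReal (Real.exp (-N x ^ 2)) ≤
      ENNReal.ofReal (Real.exp (-(3 / 2 * β))) *
        ∫⁻ x, ENNReal.ofReal (Real.exp (-(1 / 4) * N x ^ 2)) := by
  rw [← lintegral_const_mul' _ _ ENNReal.ofReal_ne_top]
  refine (setLIntegral_mono' hm fun x hx => ?_).trans (setLIntegral_le_lintegral _ _)
  rw [← ENNReal.ofReal_mul (Real.exp_pos _).le, ← Real.exp_add]
  refine ENNReal.ofReal_le_ofReal (Real.exp_le_exp.2 ?_)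
  have : 2 * β < N x ^ 2 := hx
  linarith

/-- The enhanced weak type estimate for the majorant averaged over a probability measure. With
`β = log α`, the region `N ^ 2 < β / 2` does not contribute because the majorant is bounded, and
the region `2 β < N ^ 2` has mass `O(α ^ (-3 / 2))`. -/
theorem exists_superlevel_majorant_le (h : IsExpandingFlow N D a b) {c d C₀ : ℝ} (hc : 0 < c)
    (hd : 0 < d) (hC₀ : 0 < C₀) :
    ∃ C : ℝ, 0 < C ∧ ∀ μ : Measure (Fin n → ℝ), IsProbabilityMeasure μ → ∀ α : ℝ, 2 < α →
      ∫⁻ x in {x | ENNReal.ofReal α < ENNReal.ofReal (C₀ * Real.exp (N x ^ 2)) *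
          ∫⁻ u, variationMajorant N D c d x u ∂μ}, ENNReal.ofReal (Real.exp (-N x ^ 2)) ≤
        ENNReal.ofReal (C / (α * √(Real.log α))) := by
  obtain ⟨C₁, hC₁, h₁⟩ := h.exists_setLIntegral_annulus_le hc hd
  obtain ⟨K, hK, hKle⟩ := h.exists_variationMajorant_le hc hd
  set G := ∫⁻ x, ENNReal.ofReal (Real.exp (-(1 / 4) * N x ^ 2)) with hG
  have hGtop : G ≠ ∞ := (h.lintegral_gaussian_lt_top (by norm_num)).ne
  set M := max 2 (2 * Real.log (C₀ * K)) with hM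
  have hM0 : 0 < M := lt_max_of_lt_left two_pos
  refine ⟨C₁ * C₀ + G.toReal * (Real.exp M * √M) + G.toReal, by positivity, fun μ hμ α hα => ?_⟩
  have hα0 : 0 < α := by linarith
  have hβ0 : 0 < Real.log α := Real.log_pos (by linarith)
  set β := Real.log α with hβ
  have hαβ : α = Real.exp β := (Real.exp_log hα0).symm
  have hNm : Measurable fun x => N x ^ 2 := h.continuous_norm.measurable.pow_const 2
  rcases le_or_gt M β with hMβ | hMβ
  · have hβ2 : 2 ≤ β := (le_max_left _ _).trans hMβ
    have hCK : C₀ * K ≤ Real.exp (β / 2) := by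
      rw [← Real.log_le_iff_le_exp (by positivity)]
      have := (le_max_right 2 (2 * Real.log (C₀ * K))).trans hMβ
      linarith
    set E := {x | ENNReal.ofReal α < ENNReal.ofReal (C₀ * Real.exp (N x ^ 2)) *
          ∫⁻ u, variationMajorant N D c d x u ∂μ} with hE
    set A := {x | β / 2 ≤ N x ^ 2 ∧ N x ^ 2 ≤ 2 * β ∧
          ENNReal.ofReal (α / C₀) ≤ ENNReal.ofReal (Real.exp (N x ^ 2)) *
            ∫⁻ u, variationMajorant N D c d x u ∂μ} with hA
    have hsub : E ⊆ A ∪ {x | 2 * β < N x ^ 2} := fun x hx => by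
      by_cases hx2 : 2 * β < N x ^ 2
      · exact Or.inr hx2
      have hx' : ENNReal.ofReal α < ENNReal.ofReal (C₀ * Real.exp (N x ^ 2)) *
          ∫⁻ u, variationMajorant N D c d x u ∂μ := hx
      refine Or.inl ⟨?_, not_lt.1 hx2, ?_⟩
      · have hbound : ∫⁻ u, variationMajorant N D c d x u ∂μ ≤ ENNReal.ofReal K := by
          refine (lintegral_mono (hKle x)).trans ?_
          rw [lintegral_const, measure_univ, mul_one]
        have h2 : ENNReal.ofReal α < ENNReal.ofReal (C₀ * Real.exp (N x ^ 2) * K) := by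
          rw [ENNReal.ofReal_mul (by positivity)]
          exact hx'.trans_le (by gcongr)
        have h3 := (ENNReal.ofReal_lt_ofReal_iff_of_nonneg hα0.le).1 h2
        have h4 : Real.exp β < Real.exp (β / 2 + N x ^ 2) := by
          rw [← hαβ, Real.exp_add]
          calc α < C₀ * Real.exp (N x ^ 2) * K := h3
            _ = (C₀ * K) * Real.exp (N x ^ 2) := by ring
            _ ≤ _ := by gcongr
        have := Real.exp_lt_exp.1 h4
        linarith
      · have h5 : ENNReal.ofReal C₀ ≠ 0 := by simpa using hC₀
        rw [← ENNReal.mul_le_mul_iff_right h5 ENNReal.ofReal_ne_top, ← mul_assoc,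
          ← ENNReal.ofReal_mul hC₀.le, ← ENNReal.ofReal_mul hC₀.le, mul_div_cancel₀ _ hC₀.ne']
        exact hx'.le
    have htail := setLIntegral_gaussian_tail_le N (β := β)
      (measurableSet_lt measurable_const hNm)
    have hexp : Real.exp (-(3 / 2 * β)) ≤ 1 / (α * √β) := by
      rw [le_div_iff₀ (by positivity)]
      have h6 : √β ≤ Real.exp (β / 2) := by
        rw [Real.sqrt_le_left (Real.exp_pos _).le, ← Real.exp_nat_mul]
        have := Real.add_one_le_exp β
        have h7 : ((2 : ℕ) : ℝ) * (β / 2) = β := by push_cast; ring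
        rw [h7]
        linarith
      calc Real.exp (-(3 / 2 * β)) * (α * √β)
          ≤ Real.exp (-(3 / 2 * β)) * (Real.exp β * Real.exp (β / 2)) := by
            rw [← hαβ]
            gcongr
        _ = 1 := by
            rw [← Real.exp_add, ← Real.exp_add, ← Real.exp_zero]
            congr 1; ring
    calc ∫⁻ x in E, ENNReal.ofReal (Real.exp (-N x ^ 2))
        ≤ ∫⁻ x in A ∪ {x | 2 * β < N x ^ 2}, ENNReal.ofReal (Real.exp (-N x ^ 2)) :=
          lintegral_mono_set hsub
      _ ≤ (∫⁻ x in A, ENNReal.ofReal (Real.exp (-N x ^ 2))) +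
          ∫⁻ x in {x | 2 * β < N x ^ 2}, ENNReal.ofReal (Real.exp (-N x ^ 2)) :=
          lintegral_union_le _ _ _
      _ ≤ ENNReal.ofReal (C₁ / (α / C₀ * √β)) + ENNReal.ofReal (1 / (α * √β)) *
          ENNReal.ofReal G.toReal := by
          refine add_le_add (h₁ β (α / C₀) hβ2 (by positivity) μ hμ) (htail.trans ?_)
          rw [ENNReal.ofReal_toReal hGtop]
          gcongr
      _ = ENNReal.ofReal ((C₁ * C₀ + G.toReal) / (α * √β)) := by
          rw [← ENNReal.ofReal_mul (by positivity), ← ENNReal.ofReal_add (by positivity)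
            (by positivity)]
          congr 1
          field_simp
      _ ≤ _ := by
          refine ENNReal.ofReal_le_ofReal ?_
          gcongr ?_ / _
          have : 0 ≤ G.toReal * (Real.exp M * √M) := by positivity
          linarith
  · calc _ ≤ ∫⁻ x, ENNReal.ofReal (Real.exp (-N x ^ 2)) := setLIntegral_le_lintegral _ _
      _ ≤ G := by
          refine lintegral_mono fun x => ENNReal.ofReal_le_ofReal (Real.exp_le_exp.2 ?_)
          nlinarith [sq_nonneg (N x)]
      _ = ENNReal.ofReal G.toReal := (ENNReal.ofReal_toReal hGtop).symm
      _ ≤ _ := by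
          refine ENNReal.ofReal_le_ofReal ?_
          rw [le_div_iff₀ (by positivity)]
          have h8 : α * √β ≤ Real.exp M * √M := by
            rw [hαβ]
            gcongr
          calc G.toReal * (α * √β) ≤ G.toReal * (Real.exp M * √M) := by gcongr
            _ ≤ _ := by
              have : 0 < C₁ * C₀ := by positivity
              have := ENNReal.toReal_nonneg (a := G)
              linarith

end IsExpandingFlow

/-! ### Variation seminorms -/

section Variation

lemma sum_rpow_le_rpow_sum {ι : Type*} (s : Finset ι) (g : ι → ℝ≥0∞) {p : ℝ} (hp : 1 ≤ p) :
    ∑ i ∈ s, g i ^ p ≤ (∑ i ∈ s, g i) ^ p := by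
  classical
  induction s using Finset.induction_on with
  | empty => simp
  | insert i s hi ih =>
    rw [Finset.sum_insert hi, Finset.sum_insert hi]
    exact (add_le_add_right ih _).trans (ENNReal.add_rpow_le_rpow_add _ _ hp)

lemma variation_le {ϱ : ℝ} (hϱ : 1 ≤ ϱ) {I : Set ℝ} {φ : ℝ → ℝ} {M : ℝ≥0∞}
    (h : ∀ (N : ℕ) (t : Fin (N + 1) → ℝ), StrictMono t → (∀ i, t i ∈ I) →
      ∑ i : Fin N, ENNReal.ofReal |φ (t i.succ) - φ (t i.castSucc)| ≤ M) :
    variation ϱ I φ ≤ M := by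
  refine iSup_le fun N => iSup_le fun t => iSup_le fun ht => iSup_le fun hI => ?_
  have hϱ0 : ϱ ≠ 0 := by linarith
  refine le_trans ?_ (h N t ht hI)
  calc _ ≤ ((∑ i : Fin N, ENNReal.ofReal |φ (t i.succ) - φ (t i.castSucc)|) ^ ϱ) ^ (1 / ϱ) :=
        ENNReal.rpow_le_rpow (sum_rpow_le_rpow_sum _ _ hϱ) (by positivity)
    _ = _ := by rw [← ENNReal.rpow_mul, mul_one_div_cancel hϱ0, ENNReal.rpow_one]

lemma abs_sub_le_setLIntegral {φ k : ℝ → ℝ} (hk : Continuous k) (hk0 : ∀ t, 0 ≤ k t)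
    (h : ∀ t, 1 ≤ t → ∃ d, HasDerivAt φ d t ∧ |d| ≤ k t) {r s : ℝ} (hr : 1 ≤ r) (hrs : r ≤ s) :
    ENNReal.ofReal |φ s - φ r| ≤ ∫⁻ t in Ioc r s, ENNReal.ofReal (k t) := by
  have h' : ∀ t, ∃ d, 1 ≤ t → HasDerivAt φ d t ∧ |d| ≤ k t := fun t => by
    by_cases ht : 1 ≤ t
    · obtain ⟨d, hd⟩ := h t ht
      exact ⟨d, fun _ => hd⟩
    · exact ⟨0, fun h0 => absurd h0 ht⟩
  choose d hd using h'
  have key := image_norm_le_of_norm_deriv_right_le_deriv_boundary (a := r) (b := s)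
    (f := fun t => φ t - φ r) (f' := d) (B := fun t => ∫ y in r..t, k y) (B' := k)
    (fun t ht => (((hd t (hr.trans ht.1)).1.continuousAt).sub
      continuousAt_const).continuousWithinAt)
    (fun t ht => ((hd t (hr.trans ht.1)).1.sub_const _).hasDerivWithinAt)
    (by simp) (fun t => (hk.integral_hasStrictDerivAt r t).hasDerivAt)
    (fun t ht => (hd t (hr.trans ht.1)).2) (right_mem_Icc.2 hrs)
  rw [← ofReal_integral_eq_lintegral_ofReal (hk.integrableOn_Ioc) (Eventually.of_forall hk0),
    ← intervalIntegral.integral_of_le hrs]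
  exact ENNReal.ofReal_le_ofReal key

/-- The `ℓ¹` variation sums of a function are bounded by the integral of a bound for its
derivative. -/
lemma sum_abs_sub_le_setLIntegral {φ k : ℝ → ℝ} (hk : Continuous k) (hk0 : ∀ t, 0 ≤ k t)
    (h : ∀ t, 1 ≤ t → ∃ d, HasDerivAt φ d t ∧ |d| ≤ k t) {N : ℕ} {t : Fin (N + 1) → ℝ}
    (ht : StrictMono t) (hI : ∀ i, t i ∈ Ici (1 : ℝ)) :
    ∑ i : Fin N, ENNReal.ofReal |φ (t i.succ) - φ (t i.castSucc)| ≤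
      ∫⁻ s in Ioi 1, ENNReal.ofReal (k s) := by
  have hdisj : Pairwise (Function.onFun Disjoint
      fun i : Fin N => Ioc (t i.castSucc) (t i.succ)) := by
    have aux : ∀ i j : Fin N, i < j →
        Disjoint (Ioc (t i.castSucc) (t i.succ)) (Ioc (t j.castSucc) (t j.succ)) :=
      fun i j hij => by
        have h1 : t i.succ ≤ t j.castSucc := ht.monotone (Fin.succ_le_castSucc_iff.2 hij)
        exact Set.disjoint_left.2 fun y hy hy' => absurd hy'.1 (not_lt.2 (hy.2.trans h1))
    intro i j hij
    rcases lt_or_gt_of_ne hij with h | h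
    · exact aux i j h
    · exact (aux j i h).symm
  calc ∑ i : Fin N, ENNReal.ofReal |φ (t i.succ) - φ (t i.castSucc)|
      ≤ ∑ i : Fin N, ∫⁻ s in Ioc (t i.castSucc) (t i.succ), ENNReal.ofReal (k s) :=
        Finset.sum_le_sum fun i _ => abs_sub_le_setLIntegral hk hk0 h (hI _)
          (ht.monotone (Fin.castSucc_lt_succ (i := i)).le)
    _ = ∫⁻ s in ⋃ i : Fin N, Ioc (t i.castSucc) (t i.succ), ENNReal.ofReal (k s) := by
        rw [lintegral_iUnion (fun _ => measurableSet_Ioc) hdisj, tsum_fintype]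
    _ ≤ _ := lintegral_mono_set (iUnion_subset fun i s hs => (hI i.castSucc).trans_lt hs.1)

/-- For a family of functions continuous in time, the variation seminorm is a supremum over
countably many partitions, hence measurable in the parameter. -/
lemma measurable_variation {X : Type*} [MeasurableSpace X] (ϱ : ℝ) {I : Set ℝ} {φ : X → ℝ → ℝ}
    (hm : ∀ t ∈ I, Measurable fun x => φ x t) (hc : ∀ x, ContinuousOn (φ x) I) :
    Measurable fun x => variation ϱ I (φ x) := by
  let T : ℕ → Type := fun N => {t : Fin (N + 1) → ℝ // StrictMono t ∧ ∀ i, t i ∈ I}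
  let F : (N : ℕ) → T N → X → ℝ≥0∞ := fun N τ x =>
    (∑ i : Fin N, ENNReal.ofReal |φ x (τ.1 i.succ) - φ x (τ.1 i.castSucc)| ^ ϱ) ^ (1 / ϱ)
  have hF : ∀ x, variation ϱ I (φ x) = ⨆ N, ⨆ τ : T N, F N τ x := fun x => by
    rw [variation]
    congr 1; ext N
    rw [iSup_subtype]
    congr 1; ext t
    rw [iSup_and]
  have hFm : ∀ N τ, Measurable (F N τ) := fun N τ => by
    refine Measurable.pow_const (Finset.measurable_sum _ fun i _ => ?_) _
    refine Measurable.pow_const (Measurable.ennreal_ofReal ?_) _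
    exact ((hm _ (τ.2.2 _)).sub (hm _ (τ.2.2 _))).abs
  have hFc : ∀ N x, Continuous fun τ : T N => F N τ x := fun N x => by
    have hp : ∀ j : Fin (N + 1), Continuous fun τ : T N => φ x (τ.1 j) := fun j =>
      (hc x).comp_continuous ((continuous_apply j).comp continuous_subtype_val) fun τ => τ.2.2 j
    refine ENNReal.continuous_rpow_const.comp (continuous_finsetSum _ fun i _ => ?_)
    exact ENNReal.continuous_rpow_const.comp
      (ENNReal.continuous_ofReal.comp ((hp _).sub (hp _)).abs)
  have hcount : ∀ N, ∃ S : Set (T N), S.Countable ∧ Dense S := fun N =>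
    TopologicalSpace.exists_countable_dense _
  choose S hSc hSd using hcount
  have hsup : ∀ N x, ⨆ τ : T N, F N τ x = ⨆ τ ∈ S N, F N τ x := fun N x => by
    refine le_antisymm (iSup_le fun τ => ?_) (iSup₂_le fun τ _ => le_iSup (fun τ => F N τ x) τ)
    have hcl : IsClosed {τ : T N | F N τ x ≤ ⨆ τ ∈ S N, F N τ x} :=
      isClosed_le (hFc N x) continuous_const
    exact hcl.closure_subset_iff.2 (fun τ hτ => le_iSup₂ (f := fun τ _ => F N τ x) τ hτ)
      (hSd N τ)
  simp only [hF, hsup]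
  exact Measurable.iSup fun N => Measurable.biSup _ (hSc N) fun τ _ => hFm N τ

end Variation

lemma IsExpandingFlow.continuous_majorant_integrand {N : Seminorm ℝ (Fin n → ℝ)}
    {D : ℝ → Matrix (Fin n) (Fin n) ℝ} {a b : ℝ} (h : IsExpandingFlow N D a b) (A c d : ℝ)
    (x u : Fin n → ℝ) :
    Continuous fun s => A * (Real.exp (-c * N (x - D (-s) *ᵥ u) ^ 2) *
      (Real.exp (-d * s) + N (D (-s) *ᵥ u))) := by
  have hv : Continuous fun s : ℝ => D (-s) *ᵥ u :=
    (h.continuous_flow.comp continuous_neg).matrix_mulVec continuous_const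
  have hN := h.continuous_norm
  have h1 : Continuous fun s : ℝ => N (D (-s) *ᵥ u) := hN.comp hv
  have h2 : Continuous fun s : ℝ => N (x - D (-s) *ᵥ u) := hN.comp (continuous_const.sub hv)
  fun_prop

lemma IsExpandingFlow.sum_abs_sub_le_variationMajorant {N : Seminorm ℝ (Fin n → ℝ)}
    {D : ℝ → Matrix (Fin n) (Fin n) ℝ} {a b : ℝ} (h : IsExpandingFlow N D a b) {A c d : ℝ}
    (hA : 0 ≤ A) {x u : Fin n → ℝ} {φ : ℝ → ℝ}
    (hφ : ∀ s, 1 ≤ s → ∃ φ', HasDerivAt φ φ' s ∧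
      |φ'| ≤ A * (Real.exp (-c * N (x - D (-s) *ᵥ u) ^ 2) *
        (Real.exp (-d * s) + N (D (-s) *ᵥ u))))
    {M : ℕ} {t : Fin (M + 1) → ℝ} (ht : StrictMono t) (hI : ∀ i, t i ∈ Ici (1 : ℝ)) :
    ∑ i : Fin M, ENNReal.ofReal |φ (t i.succ) - φ (t i.castSucc)| ≤
      ENNReal.ofReal A * variationMajorant N D c d x u := by
  rw [variationMajorant, ← lintegral_const_mul' _ _ ENNReal.ofReal_ne_top]
  refine (sum_abs_sub_le_setLIntegral (h.continuous_majorant_integrand A c d x u) (fun s => ?_)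
    hφ ht hI).trans_eq (lintegral_congr fun s => ENNReal.ofReal_mul hA)
  have := apply_nonneg N (D (-s) *ᵥ u)
  positivity

/-! ### The variation operator of the semigroup -/

section Semigroup

variable {Q B : Matrix (Fin n) (Fin n) ℝ}

lemma exists_isExpandingFlow (hn : 1 ≤ n) (hQ : Q.PosDef) (hB : IsStable B) :
    ∃ a b : ℝ, IsExpandingFlow (gaussNorm hn hQ hB) (D Q B) a b := by
  obtain ⟨a, b, ha, hb, h⟩ := exists_growth_gaussNorm hn hQ hB
  refine ⟨a, b, ha, hb, exists_norm_le_formNorm _, ?_, D_zero hn hQ hB, D_add hn hQ hB,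
    continuous_D Q B, h⟩
  have hc : Continuous fun x : Fin n → ℝ => 1 / 2 * (x ⬝ᵥ ((Qinf Q B)⁻¹ *ᵥ x)) := by fun_prop
  exact Real.continuous_sqrt.comp hc

lemma exists_gammaInf_apply_eq (hn : 1 ≤ n) (hQ : Q.PosDef) (hB : IsStable B) :
    ∃ Z : ℝ, 0 < Z ∧ ∀ S : Set (Fin n → ℝ), gammaInf Q B S =
      ENNReal.ofReal Z * ∫⁻ x in S, ENNReal.ofReal (Real.exp (-gaussNorm hn hQ hB x ^ 2)) := by
  have hdet := (posDef_Qinf hn hQ hB).det_pos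
  refine ⟨(2 * Real.pi) ^ (-(n : ℝ) / 2) * (Qinf Q B).det ^ (-(1 : ℝ) / 2), by positivity,
    fun S => ?_⟩
  rw [gammaInf, withDensity_apply', ← lintegral_const_mul' _ _ ENNReal.ofReal_ne_top]
  refine lintegral_congr fun x => ?_
  rw [← ENNReal.ofReal_mul (by positivity), gaussNorm_sq, R, neg_mul]

lemma isFiniteMeasure_gammaInf (hn : 1 ≤ n) (hQ : Q.PosDef) (hB : IsStable B) :
    IsFiniteMeasure (gammaInf Q B) := by
  obtain ⟨a, b, h⟩ := exists_isExpandingFlow hn hQ hB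
  obtain ⟨Z, hZ, hγ⟩ := exists_gammaInf_apply_eq hn hQ hB
  refine ⟨?_⟩
  rw [hγ, Measure.restrict_univ]
  have := h.lintegral_gaussian_lt_top one_pos
  simp only [neg_one_mul] at this
  exact ENNReal.mul_lt_top ENNReal.ofReal_lt_top this

lemma continuous_mehlerKernel (Q B : Matrix (Fin n) (Fin n) ℝ) (t : ℝ) :
    Continuous fun p : (Fin n → ℝ) × (Fin n → ℝ) => mehlerKernel Q B t p.1 p.2 := by
  unfold mehlerKernel R
  fun_prop

lemma continuousOn_mehlerKernel (hn : 1 ≤ n) (hQ : Q.PosDef) (hB : IsStable B)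
    (x u : Fin n → ℝ) : ContinuousOn (fun t => mehlerKernel Q B t x u) (Ici 1) := by
  obtain ⟨C, c, hC, hc, h⟩ := exists_bound_deriv_mehlerKernel hn hQ hB
  intro t ht
  obtain ⟨-, d, hd, -⟩ := h t ht x u
  exact hd.continuousAt.continuousWithinAt

lemma aestronglyMeasurable_mehlerKernel (t : ℝ) (x : Fin n → ℝ) :
    AEStronglyMeasurable (fun u => mehlerKernel Q B t x u) (gammaInf Q B) :=
  ((continuous_mehlerKernel Q B t).comp
    (continuous_const.prodMk continuous_id)).aestronglyMeasurable

lemma integrable_mehlerKernel_mul (hn : 1 ≤ n) (hQ : Q.PosDef) (hB : IsStable B)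
    {f : (Fin n → ℝ) → ℝ} (hf : Integrable f (gammaInf Q B)) {t : ℝ} (ht : 1 ≤ t)
    (x : Fin n → ℝ) : Integrable (fun u => mehlerKernel Q B t x u * f u) (gammaInf Q B) := by
  obtain ⟨C, c, hC, hc, h⟩ := exists_bound_deriv_mehlerKernel hn hQ hB
  exact hf.bdd_mul (aestronglyMeasurable_mehlerKernel t x)
    (Eventually.of_forall fun u => (h t ht x u).1)

lemma continuousOn_semigroup (hn : 1 ≤ n) (hQ : Q.PosDef) (hB : IsStable B)
    {f : (Fin n → ℝ) → ℝ} (hf : Integrable f (gammaInf Q B)) (x : Fin n → ℝ) :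
    ContinuousOn (fun t => semigroup Q B t f x) (Ici 1) := by
  obtain ⟨C, c, hC, hc, h⟩ := exists_bound_deriv_mehlerKernel hn hQ hB
  refine continuousOn_of_dominated
    (bound := fun u => C * Real.exp (gaussNorm hn hQ hB x ^ 2) * ‖f u‖)
    (fun t ht => (integrable_mehlerKernel_mul hn hQ hB hf ht x).aestronglyMeasurable)
    (fun t ht => Eventually.of_forall fun u => ?_) (hf.norm.const_mul _)
    (Eventually.of_forall fun u => (continuousOn_mehlerKernel hn hQ hB x u).mul continuousOn_const)
  rw [norm_mul]
  gcongr
  exact (h t ht x u).1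

lemma measurable_semigroup [SFinite (gammaInf Q B)] {f : (Fin n → ℝ) → ℝ}
    (hf : StronglyMeasurable f) (t : ℝ) : Measurable fun x => semigroup Q B t f x := by
  have h : StronglyMeasurable fun p : (Fin n → ℝ) × (Fin n → ℝ) =>
      mehlerKernel Q B t p.1 p.2 * f p.2 :=
    (continuous_mehlerKernel Q B t).stronglyMeasurable.mul (hf.comp_measurable measurable_snd)
  exact h.integral_prod_right'.measurable

lemma semigroup_congr {f g : (Fin n → ℝ) → ℝ} (h : f =ᵐ[gammaInf Q B] g) (t : ℝ)
    (x : Fin n → ℝ) : semigroup Q B t f x = semigroup Q B t g x := by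
  refine integral_congr_ae ?_
  filter_upwards [h] with u hu
  rw [hu]

lemma measurable_variationOp (hn : 1 ≤ n) (hQ : Q.PosDef) (hB : IsStable B) (ϱ : ℝ)
    {f : (Fin n → ℝ) → ℝ} (hf : Integrable f (gammaInf Q B)) :
    Measurable (variationOp Q B ϱ (Ici 1) f) := by
  have := isFiniteMeasure_gammaInf hn hQ hB
  have hcongr := semigroup_congr (hf.1.ae_eq_mk)
  refine measurable_variation ϱ (φ := fun x t => semigroup Q B t f x) (fun t _ => ?_)
    fun x => continuousOn_semigroup hn hQ hB hf x
  simp only [hcongr]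
  exact measurable_semigroup hf.1.stronglyMeasurable_mk t

/-- The variation operator is dominated by the positive operator with kernel
`e^{N(x) ^ 2}` times the variation majorant. -/
lemma exists_variationOp_le (hn : 1 ≤ n) (hQ : Q.PosDef) (hB : IsStable B) :
    ∃ C c : ℝ, 0 < C ∧ 0 < c ∧ ∀ ϱ : ℝ, 1 ≤ ϱ → ∀ f : (Fin n → ℝ) → ℝ,
      Integrable f (gammaInf Q B) → ∀ x, variationOp Q B ϱ (Ici 1) f x ≤
        ENNReal.ofReal (C * Real.exp (gaussNorm hn hQ hB x ^ 2)) *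
          ∫⁻ u, ‖f u‖ₑ * IsExpandingFlow.variationMajorant (gaussNorm hn hQ hB) (D Q B) (1 / 2) c
            x u ∂(gammaInf Q B) := by
  obtain ⟨a, b, hflow⟩ := exists_isExpandingFlow hn hQ hB
  obtain ⟨C, c, hC, hc, h⟩ := exists_bound_deriv_mehlerKernel hn hQ hB
  refine ⟨C, c, hC, hc, fun ϱ hϱ f hf x => variation_le hϱ fun M t ht hI => ?_⟩
  set N := gaussNorm hn hQ hB
  set A := C * Real.exp (N x ^ 2) with hA
  have hA0 : 0 < A := by positivity
  have hsum : ∀ u, ∑ i : Fin M, ENNReal.ofReal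
      |mehlerKernel Q B (t i.succ) x u - mehlerKernel Q B (t i.castSucc) x u| ≤
      ENNReal.ofReal A * IsExpandingFlow.variationMajorant N (D Q B) (1 / 2) c x u := fun u =>
    hflow.sum_abs_sub_le_variationMajorant hA0.le (fun s hs => (h s hs x u).2) ht hI
  have hterm : ∀ i : Fin M, ENNReal.ofReal
      |semigroup Q B (t i.succ) f x - semigroup Q B (t i.castSucc) f x| ≤
      ∫⁻ u, ENNReal.ofReal
        |mehlerKernel Q B (t i.succ) x u - mehlerKernel Q B (t i.castSucc) x u| * ‖f u‖ₑ
        ∂(gammaInf Q B) := fun i => by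
    rw [semigroup, semigroup, ← integral_sub (integrable_mehlerKernel_mul hn hQ hB hf (hI _) x)
      (integrable_mehlerKernel_mul hn hQ hB hf (hI _) x), ← Real.norm_eq_abs, ofReal_norm]
    refine (enorm_integral_le_lintegral_enorm _).trans_eq (lintegral_congr fun u => ?_)
    rw [← sub_mul, enorm_mul, ← Real.norm_eq_abs, ofReal_norm]
  calc ∑ i : Fin M, ENNReal.ofReal
        |semigroup Q B (t i.succ) f x - semigroup Q B (t i.castSucc) f x|
      ≤ ∑ i : Fin M, ∫⁻ u, ENNReal.ofReal
        |mehlerKernel Q B (t i.succ) x u - mehlerKernel Q B (t i.castSucc) x u| * ‖f u‖ₑ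
        ∂(gammaInf Q B) := Finset.sum_le_sum fun i _ => hterm i
    _ = ∫⁻ u, (∑ i : Fin M, ENNReal.ofReal
        |mehlerKernel Q B (t i.succ) x u - mehlerKernel Q B (t i.castSucc) x u|) * ‖f u‖ₑ
        ∂(gammaInf Q B) := by
        rw [← lintegral_finsetSum']
        · simp only [Finset.sum_mul]
        · intro i _
          refine AEMeasurable.mul ?_ hf.1.enorm
          exact (((aestronglyMeasurable_mehlerKernel _ x).sub
            (aestronglyMeasurable_mehlerKernel _ x)).aemeasurable.abs).ennreal_ofReal
    _ ≤ ∫⁻ u, ENNReal.ofReal A * (‖f u‖ₑ *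
        IsExpandingFlow.variationMajorant N (D Q B) (1 / 2) c x u) ∂(gammaInf Q B) := by
        refine lintegral_mono fun u => ?_
        rw [mul_left_comm, mul_comm ‖f u‖ₑ, mul_comm _ (‖f u‖ₑ), mul_comm _ (‖f u‖ₑ)]
        gcongr
        exact hsum u
    _ = _ := lintegral_const_mul' _ _ ENNReal.ofReal_ne_top

/-- The enhanced weak type estimate, for functions that are not normalized. -/
lemma exists_gammaInf_variationOp_le (hn : 1 ≤ n) (hQ : Q.PosDef) (hB : IsStable B) :
    ∃ C : ℝ, 0 < C ∧ ∀ ϱ : ℝ, 1 ≤ ϱ → ∀ f : (Fin n → ℝ) → ℝ, Integrable f (gammaInf Q B) →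
      0 < ∫ x, |f x| ∂(gammaInf Q B) → ∀ α : ℝ, 2 < α →
      gammaInf Q B {x | ENNReal.ofReal (α * ∫ x, |f x| ∂(gammaInf Q B)) <
          variationOp Q B ϱ (Ici 1) f x} ≤
        ENNReal.ofReal (C / (α * √(Real.log α))) := by
  obtain ⟨a, b, hflow⟩ := exists_isExpandingFlow hn hQ hB
  obtain ⟨C₀, c, hC₀, hc, hvar⟩ := exists_variationOp_le hn hQ hB
  obtain ⟨Z, hZ, hγ⟩ := exists_gammaInf_apply_eq hn hQ hB
  obtain ⟨C, hC, hmain⟩ := hflow.exists_superlevel_majorant_le (c := 1 / 2) (by norm_num) hc hC₀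
  refine ⟨Z * C, by positivity, fun ϱ hϱ f hf hI α hα => ?_⟩
  set I := ∫ x, |f x| ∂(gammaInf Q B) with hIdef
  have hIe : ENNReal.ofReal I = ∫⁻ x, ‖f x‖ₑ ∂(gammaInf Q B) :=
    ofReal_integral_norm_eq_lintegral_enorm hf
  have hIne : ENNReal.ofReal I ≠ 0 := by simpa using hI
  set μ := (ENNReal.ofReal I)⁻¹ • (gammaInf Q B).withDensity fun u => ‖f u‖ₑ with hμ
  have hprob : IsProbabilityMeasure μ := ⟨by
    rw [hμ, Measure.smul_apply, withDensity_apply _ MeasurableSet.univ, Measure.restrict_univ,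
      ← hIe, smul_eq_mul, ENNReal.inv_mul_cancel hIne ENNReal.ofReal_ne_top]⟩
  have hint : ∀ g : (Fin n → ℝ) → ℝ≥0∞,
      ∫⁻ u, ‖f u‖ₑ * g u ∂(gammaInf Q B) = ENNReal.ofReal I * ∫⁻ u, g u ∂μ := fun g => by
    rw [hμ, lintegral_smul_measure, lintegral_withDensity_eq_lintegral_mul_non_measurable₀ _
      hf.1.enorm (Eventually.of_forall fun _ => enorm_lt_top), smul_eq_mul, ← mul_assoc,
      ENNReal.mul_inv_cancel hIne ENNReal.ofReal_ne_top, one_mul]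
    rfl
  rw [hγ]
  have hα0 : 0 < α := by linarith
  calc _ ≤ ENNReal.ofReal Z * ∫⁻ x in {x | ENNReal.ofReal α <
        ENNReal.ofReal (C₀ * Real.exp (gaussNorm hn hQ hB x ^ 2)) *
          ∫⁻ u, IsExpandingFlow.variationMajorant (gaussNorm hn hQ hB) (D Q B) (1 / 2) c x u ∂μ},
        ENNReal.ofReal (Real.exp (-gaussNorm hn hQ hB x ^ 2)) := by
        refine mul_le_mul_right (lintegral_mono_set fun x hx => ?_) _
        have h1 := lt_of_lt_of_le (Set.mem_ofPred_eq ▸ hx : _ < _) (hvar ϱ hϱ f hf x)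
        rw [hint, ENNReal.ofReal_mul hα0.le, mul_left_comm, mul_comm] at h1
        exact (ENNReal.mul_lt_mul_iff_right hIne ENNReal.ofReal_ne_top).1 h1
    _ ≤ ENNReal.ofReal Z * ENNReal.ofReal (C / (α * √(Real.log α))) := by
        gcongr
        exact hmain μ hprob α hα
    _ = _ := by rw [← ENNReal.ofReal_mul hZ.le, mul_div_assoc]

lemma variationOp_eq_zero {ϱ : ℝ} (hϱ : 1 ≤ ϱ)
    {f : (Fin n → ℝ) → ℝ} (hf : Integrable f (gammaInf Q B))
    (h0 : ∫ x, |f x| ∂(gammaInf Q B) = 0) (x : Fin n → ℝ) :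
    variationOp Q B ϱ (Ici 1) f x = 0 := by
  have h1 : (fun x => |f x|) =ᵐ[gammaInf Q B] 0 :=
    (integral_eq_zero_iff_of_nonneg (fun x => abs_nonneg (f x)) hf.abs).1 h0
  have h2 : f =ᵐ[gammaInf Q B] 0 := by
    filter_upwards [h1] with u hu
    simpa using hu
  refine le_antisymm (variation_le hϱ fun M t _ _ => ?_) zero_le
  simp only [semigroup_congr h2]
  simp [semigroup]

end Semigroup

end OrnsteinUhlenbeck

theorem theorem4p3 {n : ℕ} (hn : 1 ≤ n) (Q B : Matrix (Fin n) (Fin n) ℝ)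
    (hQ : Q.PosDef) (hB : OrnsteinUhlenbeck.IsStable B) :
    ∃ C : ℝ, 0 < C ∧ ∀ ϱ : ℝ, 1 ≤ ϱ → ∀ f : (Fin n → ℝ) → ℝ,
      Integrable f (OrnsteinUhlenbeck.gammaInf Q B) →
        -- the integrals that define the operator converge, and its values are measurable
        (∀ t : ℝ, 1 ≤ t → ∀ x : Fin n → ℝ,
          Integrable (fun u => OrnsteinUhlenbeck.mehlerKernel Q B t x u * f u)
            (OrnsteinUhlenbeck.gammaInf Q B)) ∧
        Measurable (OrnsteinUhlenbeck.variationOp Q B ϱ (Set.Ici 1) f) ∧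
        -- weak type (1,1)
        (∀ α : ℝ, 0 < α →
          OrnsteinUhlenbeck.gammaInf Q B
              {x | ENNReal.ofReal α < OrnsteinUhlenbeck.variationOp Q B ϱ (Set.Ici 1) f x} ≤
            ENNReal.ofReal (C / α * ∫ x, |f x| ∂(OrnsteinUhlenbeck.gammaInf Q B))) ∧
        -- the enhanced bound for normalized functions
        ((∫ x, |f x| ∂(OrnsteinUhlenbeck.gammaInf Q B)) = 1 → ∀ α : ℝ, 2 < α →
          OrnsteinUhlenbeck.gammaInf Q B
              {x | ENNReal.ofReal α < OrnsteinUhlenbeck.variationOp Q B ϱ (Set.Ici 1) f x} ≤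
            ENNReal.ofReal (C / (α * Real.sqrt (Real.log α)))) := by
  obtain ⟨C, hC, hmain⟩ := OrnsteinUhlenbeck.exists_gammaInf_variationOp_le hn hQ hB
  have hfin := OrnsteinUhlenbeck.isFiniteMeasure_gammaInf hn hQ hB
  have hlog2 : 0 < √(Real.log 2) := Real.sqrt_pos.2 (Real.log_pos one_lt_two)
  set M := (OrnsteinUhlenbeck.gammaInf Q B Set.univ).toReal with hM
  refine ⟨C / √(Real.log 2) + 2 * M + C, by positivity, fun ϱ hϱ f hf =>
    ⟨fun t ht x => OrnsteinUhlenbeck.integrable_mehlerKernel_mul hn hQ hB hf ht x,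
      OrnsteinUhlenbeck.measurable_variationOp hn hQ hB ϱ hf, fun α hα => ?_, fun h1 α hα => ?_⟩⟩
  · have hI0 : 0 ≤ ∫ x, |f x| ∂(OrnsteinUhlenbeck.gammaInf Q B) := integral_nonneg fun x => abs_nonneg _
    rcases hI0.eq_or_lt with h0 | hI
    · simp [OrnsteinUhlenbeck.variationOp_eq_zero hϱ hf h0.symm]
    set I := ∫ x, |f x| ∂(OrnsteinUhlenbeck.gammaInf Q B) with hIdef
    have hαI : α / I * I = α := div_mul_cancel₀ _ hI.ne'
    rcases le_or_gt (α / I) 2 with hle | hlt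
    · calc _ ≤ OrnsteinUhlenbeck.gammaInf Q B Set.univ := measure_mono (Set.subset_univ _)
        _ = ENNReal.ofReal M := (ENNReal.ofReal_toReal (measure_ne_top _ _)).symm
        _ ≤ _ := by
          refine ENNReal.ofReal_le_ofReal ?_
          rw [div_mul_eq_mul_div, le_div_iff₀ hα]
          have h2 : α ≤ 2 * I := by rwa [div_le_iff₀ hI] at hle
          calc M * α ≤ M * (2 * I) := by gcongr
            _ = (0 + 2 * M + 0) * I := by ring
            _ ≤ _ := by gcongr; positivity
    · have h := hmain ϱ hϱ f hf hI (α / I) hlt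
      rw [← hIdef, hαI] at h
      refine h.trans (ENNReal.ofReal_le_ofReal ?_)
      have hle : √(Real.log 2) ≤ √(Real.log (α / I)) :=
        Real.sqrt_le_sqrt (Real.log_le_log two_pos hlt.le)
      calc C / (α / I * √(Real.log (α / I))) ≤ C / (α / I * √(Real.log 2)) := by gcongr
        _ = (C / √(Real.log 2) + 0 + 0) / α * I := by field_simp; ring
        _ ≤ _ := by gcongr; positivity
  · have h := hmain ϱ hϱ f hf (by rw [h1]; exact one_pos) α hα
    rw [h1, mul_one] at h
    refine h.trans (ENNReal.ofReal_le_ofReal ?_)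
    gcongr
    have : 0 ≤ C / √(Real.log 2) + 2 * M := by positivity
    linarith
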